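/- Let $\mathbb D\in\{\mathbb R,\mathbb T\}$ with $\mathbb T=\mathbb R/2\pi\mathbb Z$, and let $V,f\colon\mathbb D^d\to\mathbb R$ be smooth, with $\mathrm e^{-V}$ Lebesgue integrable, $Z=\int_{\mathbb D^d}\mathrm e^{-V}$, $\mu=Z^{-1}\mathrm e^{-V}\,\mathrm dx$, $f\in L^1(\mu)$ not $\mu$-almost everywhere constant, and $I=\int f\,\mathrm d\mu$. For a function $U$ on $\mathbb D^d$ put $Z[U]=\int_{\mathbb D^d}\mathrm e^{-V-U}$ and $\mu_U=Z[U]^{-1}\mathrm e^{-V-U}\,\mathrm dx$. Let $H^1(\mu_U)$ be the set of $\varphi\in L^2(\mu_U)$ with weak gradient $\nabla\varphi\in L^2(\mu_U)^d$, and $L^2_0(\mu_U)$ the set of $\varphi\in L^2(\mu_U)$ with $\int\varphi\,\mathrm d\mu_U=0$. Let $\mathfrak U_0$ be the set of functions $U\colon\mathbb D^d\to\mathbb R$ such that: $U$ is smooth; $\mathrm e^{-V-U}$ is Lebesgue integrable; there is $R>0$ with $\|\varphi\|_{L^2(\mu_U)}^2\le R^{-1}\|\nabla\varphi\|_{L^2(\mu_U)}^2$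 for all $\varphi\in H^1(\mu_U)\cap L^2_0(\mu_U)$; $(f-I)\mathrm e^U\in L^2(\mu_U)$; and for every $x_0\in\mathbb D^d$ the equation $\mathrm dX_t=-\nabla(V+U)(X_t)\,\mathrm dt+\sqrt2\,\mathrm dW_t$, $X_0=x_0$, has a unique strong solution. Denote by $\phi_U\in H^1(\mu_U)\cap L^2_0(\mu_U)$ the distributional solution to the Poisson equation $$-\mathcal L_U\phi_U=(f-I)\mathrm e^U,\qquad \mathcal L_U=\mathrm e^{V+U}\nabla\cdot\bigl(\mathrm e^{-V-U}\nabla\,\cdot\,\bigr),$$ and define the asymptotic variance $\sigma^2_f[U]=\dfrac{2Z[U]^2}{Z^2}\displaystyle\int_{\mathbb D^d}|\nabla\phi_U|^2\,\mathrm d\mu_U$. Theorem. Let $U\in\mathfrak U_0$ and let $\delta U\in C^\infty_{\mathrm c}(\mathbb D^d)$. For every $\varepsilon\in\mathbb R$ the solution $\phi_{U+\varepsilon\delta U}\in H^1(\mu_{U+\varepsilon\delta U})\cap L^2_0(\mu_{U+\varepsilon\delta U})$ exists and is unique up to almost everywhere equality (so that $\sigma^2_f[U+\varepsilon\delta U]$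 is well defined), the directional derivative $$\mathrm d\sigma^2_f[U]\cdot\delta U:=\lim_{\varepsilon\to0}\frac1\varepsilon\bigl(\sigma^2_f[U+\varepsilon\delta U]-\sigma^2_f[U]\bigr)$$ exists, and $$\frac12\,\mathrm d\sigma^2_f[U]\cdot\delta U=\frac{Z[U]^2}{Z^2}\int_{\mathbb D^d}\delta U\Bigl(|\nabla\phi_U|^2-\int_{\mathbb D^d}|\nabla\phi_U|^2\,\mathrm d\mu_U\Bigr)\,\mathrm d\mu_U .$$ -/

import Mathlib

open MeasureTheory ProbabilityTheory Filter Topology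
open scoped ContDiff NNReal

noncomputable section

namespace AsymVar

/-- The Euclidean space `ℝ^d`. -/
abbrev Sp (d : ℕ) : Type := EuclideanSpace ℝ (Fin d)

/-- The two possibilities for the one-dimensional domain `𝔻`: the real line `ℝ`, or the torus
`𝕋 = ℝ / 2πℤ`. -/
inductive Dom where
  | line
  | torus

/-- `IsOn D g`: the map `g` on `ℝ^d` is (the lift of) a map on `𝔻^d`.  Maps on `𝕋^d` are
identified with the maps on `ℝ^d` that are `2π`-periodic in each coordinate. -/
def IsOn {d : ℕ} {α : Type} (D : Dom) (g : Sp d → α) : Prop :=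
  match D with
  | .line => True
  | .torus => ∀ (i : Fin d) (x : Sp d), g (x + EuclideanSpace.single i (2 * Real.pi)) = g x

/-- The Lebesgue measure of `𝔻^d`; for the torus it is carried by the fundamental cell
`(-π, π]^d`. -/
def vol (D : Dom) (d : ℕ) : Measure (Sp d) :=
  match D with
  | .line => volume
  | .torus => volume.restrict {x | ∀ i, x i ∈ Set.Ioc (-Real.pi) Real.pi}

/-- `g` is a smooth real function on `𝔻^d`. -/
structure IsSmooth {d : ℕ} (D : Dom) (g : Sp d → ℝ) : Prop where
  isOn : IsOn D g
  contDiff : ContDiff ℝ ∞ g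

/-- `ξ ∈ C_c^∞(𝔻^d)`: smooth with compact support in `𝔻^d` (no condition on the support
for the torus, which is compact). -/
structure IsTest {d : ℕ} (D : Dom) (ξ : Sp d → ℝ) : Prop where
  smooth : IsSmooth D ξ
  compact : D = Dom.line → HasCompactSupport ξ

variable {d : ℕ}

/-- The normalization constant `∫_{𝔻^d} e^{-W}`. -/
def Zc (D : Dom) (W : Sp d → ℝ) : ℝ := ∫ x, Real.exp (-W x) ∂(vol D d)

/-- The probability measure on `𝔻^d` with Lebesgue density `e^{-W} / ∫ e^{-W}`.
Thus `μ = gibbs D V` and `μ_U = gibbs D (V + U)`. -/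
def gibbs (D : Dom) (W : Sp d → ℝ) : Measure (Sp d) :=
  (vol D d).withDensity fun x => ENNReal.ofReal (Real.exp (-W x) / Zc D W)

/-- The target mean `I = ∫ f dμ`. -/
def mean (D : Dom) (V f : Sp d → ℝ) : ℝ := ∫ x, f x ∂(gibbs D V)

/-- `G` is the weak gradient on `𝔻^d` of the locally integrable function `φ`. -/
structure IsWeakGrad (D : Dom) (φ : Sp d → ℝ) (G : Sp d → Sp d) : Prop where
  isOn_fun : IsOn D φ
  isOn_grad : IsOn D G
  locInt_fun : LocallyIntegrable φ (vol D d)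
  locInt_grad : LocallyIntegrable G (vol D d)
  parts : ∀ ξ : Sp d → ℝ, IsTest D ξ → ∀ i : Fin d,
    ∫ x, φ x * (gradient ξ x) i ∂(vol D d) = -∫ x, G x i * ξ x ∂(vol D d)

/-- `φ ∈ H¹(m)`, with weak gradient `G`. -/
structure MemH1 (D : Dom) (m : Measure (Sp d)) (φ : Sp d → ℝ) (G : Sp d → Sp d) : Prop where
  weakGrad : IsWeakGrad D φ G
  memLp_fun : MemLp φ 2 m
  memLp_grad : MemLp G 2 m

/-- The Poincaré inequality on `H¹(m) ∩ L²₀(m)`, with some constant `R > 0`. -/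
def Poincare (D : Dom) (m : Measure (Sp d)) : Prop :=
  ∃ R : ℝ, 0 < R ∧ ∀ (φ : Sp d → ℝ) (G : Sp d → Sp d), MemH1 D m φ G → ∫ x, φ x ∂m = 0 →
    ∫ x, φ x ^ 2 ∂m ≤ 1 / R * ∫ x, ‖G x‖ ^ 2 ∂m

/-- `W` is a standard `d`-dimensional Brownian motion: its coordinates are independent standard
real Brownian motions. -/
structure IsBM {Ω : Type} [MeasurableSpace Ω] (P : Measure Ω) (W : ℝ≥0 → Ω → Sp d) : Prop where
  coord : ∀ i : Fin d, IsBrownianReal (fun t w => W t w i) P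
  indep : iIndepFun (fun (i : Fin d) (w : Ω) (t : ℝ≥0) => W t w i) P

/-- `X` is a strong solution, driven by the Brownian motion `W` and started from `x₀`, to
`dX_t = b(X_t) dt + √2 dW_t`: it is adapted to the (completed) filtration of `W`, it has continuous
paths and it satisfies the integrated equation at all times, almost surely. -/
structure IsStrongSol {Ω : Type} [MeasurableSpace Ω] (P : Measure Ω) (W : ℝ≥0 → Ω → Sp d)
    (b : Sp d → Sp d) (x₀ : Sp d) (X : ℝ≥0 → Ω → Sp d) : Prop where
  adapted : ∀ t : ℝ≥0, AEStronglyMeasurable[⨆ s : Set.Iic t,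
    MeasurableSpace.comap (W s) inferInstance] (X t) P
  cont : ∀ᵐ w ∂P, Continuous fun t => X t w
  eq : ∀ᵐ w ∂P, ∀ t : ℝ≥0,
    X t w = x₀ + (∫ s in (0 : ℝ)..t, b (X s.toNNReal w)) + √2 • W t w

/-- From every starting point, the equation `dX_t = b(X_t) dt + √2 dW_t` has a unique strong
solution (up to indistinguishability), whatever the driving Brownian motion.  For a periodic
drift `b`, this is the equation on the torus, lifted to `ℝ^d`. -/
def StrongWellPosed (b : Sp d → Sp d) : Prop :=
  ∀ (Ω : Type) [MeasurableSpace Ω] (P : Measure Ω) [IsProbabilityMeasure P]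
    (W : ℝ≥0 → Ω → Sp d), IsBM P W → ∀ x₀ : Sp d,
      (∃ X, IsStrongSol P W b x₀ X) ∧
      ∀ X X', IsStrongSol P W b x₀ X → IsStrongSol P W b x₀ X' →
        ∀ᵐ w ∂P, ∀ t, X t w = X' t w

/-- The standing assumptions on the potential `V` and the observable `f`. -/
structure Standing (D : Dom) (V f : Sp d → ℝ) : Prop where
  smooth_pot : IsSmooth D V
  integrable_exp : Integrable (fun x => Real.exp (-V x)) (vol D d)
  smooth_obs : IsSmooth D f
  integrable_obs : Integrable f (gibbs D V)
  not_const : ¬ ∃ c : ℝ, ∀ᵐ x ∂(gibbs D V), f x = c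

/-- `U ∈ 𝔘₀(V, f)`: the class of admissible biasing potentials. -/
structure Admissible (D : Dom) (V f U : Sp d → ℝ) : Prop where
  smooth : IsSmooth D U
  integrable_exp : Integrable (fun x => Real.exp (-(V + U) x)) (vol D d)
  poincare : Poincare D (gibbs D (V + U))
  memLp : MemLp (fun x => (f x - mean D V f) * Real.exp (U x)) 2 (gibbs D (V + U))
  wellPosed : StrongWellPosed fun x => -gradient V x - gradient U x

/-- `φ`, with weak gradient `G`, is a distributional solution in `H¹(μ_U) ∩ L²₀(μ_U)` to the
Poisson equation `-𝓛_U φ = (f - I) e^U`, where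
`𝓛_U = e^{V+U} ∇ · (e^{-V-U} ∇ ·) = Δ - ∇(V + U) · ∇`.
The equation is multiplied by the density of `μ_U` and tested against `C_c^∞(𝔻^d)`. -/
structure IsPoissonSol (D : Dom) (V f U : Sp d → ℝ) (φ : Sp d → ℝ) (G : Sp d → Sp d) : Prop where
  memH1 : MemH1 D (gibbs D (V + U)) φ G
  mean_zero : ∫ x, φ x ∂(gibbs D (V + U)) = 0
  eq : ∀ ξ : Sp d → ℝ, IsTest D ξ →
    ∫ x, inner ℝ (G x) (gradient ξ x) ∂(gibbs D (V + U)) =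
      ∫ x, (f x - mean D V f) * Real.exp (U x) * ξ x ∂(gibbs D (V + U))

/-- Existence and (almost everywhere) uniqueness of the solution `φ_U` to the Poisson equation,
and of its weak gradient. -/
def PoissonWellPosed (D : Dom) (V f U : Sp d → ℝ) : Prop :=
  ∃ φ G, IsPoissonSol D V f U φ G ∧
    ∀ φ' G', IsPoissonSol D V f U φ' G' → φ' =ᵐ[vol D d] φ ∧ G' =ᵐ[vol D d] G

open Classical in
/-- The gradient `∇φ_U` of the solution to the Poisson equation (`0` if there is no solution). -/
def poissonGrad (D : Dom) (V f U : Sp d → ℝ) : Sp d → Sp d :=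
  if h : ∃ G φ, IsPoissonSol D V f U φ G then h.choose else 0

/-- The asymptotic variance `σ²_f[U] = (2 Z[U]² / Z²) ∫ |∇φ_U|² dμ_U`. -/
def asymVar (D : Dom) (V f U : Sp d → ℝ) : ℝ :=
  2 * Zc D (V + U) ^ 2 / Zc D V ^ 2 * ∫ x, ‖poissonGrad D V f U x‖ ^ 2 ∂(gibbs D (V + U))

/-- The directional derivative `dE[U] · δU = lim_{ε → 0} (E[U + ε δU] - E[U]) / ε` exists and is
equal to `L`. -/
def HasDirDeriv (E : (Sp d → ℝ) → ℝ) (U δU : Sp d → ℝ) (L : ℝ) : Prop :=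
  Tendsto (fun ε : ℝ => 1 / ε * (E (U + ε • δU) - E U)) (𝓝[≠] 0) (𝓝 L)

end AsymVar

end

noncomputable section

namespace AsymVar

variable {d : ℕ}

/-! ### Mollification on the Euclidean space -/

/-! Why the theorem holds. The factor `e^U` in the source cancels the one in the density, so that
`Z[U] ∫ (f-I) e^U ψ dμ_U = ∫ e^{-V} (f-I) ψ dx` does not depend on `U` (`Zc_mul_integral_source`).
Write `μ = μ_U`, `G = ∇φ_U`, `Γ_ε = ∇φ_{U+εδU}` and `e = exp(-ε δU)`. As `δU` is bounded, `μ` and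
`μ_{U+εδU}` are comparable and have the same `H¹`, and the perturbed equation becomes `∫ e Γ_ε · ∇ψ
dμ = ∫ G · ∇ψ dμ` for every `ψ ∈ H¹(μ)`.

Moreover `σ²[U+εδU] = (2 Z[U]²/Z²) m(ε) J(ε)` with `m(ε) = ∫ e dμ` and `J(ε) = ∫ e |Γ_ε|² dμ`.
Clearly `m'(0) = -∫ δU dμ`. For `J`, test with `φ_U` and with `φ_{U+εδU}`: the error `E = Γ_ε - G`
satisfies `∫ e |E|² dμ = ∫ (1-e) G · E dμ`. Hence `E = O(ε)` in `L²`, the right side is `O(ε²)`, and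
`J(ε) - J(0) = ∫ (1-e) |G|² dμ + O(ε²)`, so `J'(0) = ∫ δU |G|² dμ` (`hasDerivAt_energy`). The
product rule gives the formula; `φ_{U+εδU}` itself is never differentiated in `ε`.

Two analytic facts support this. First, an equation known only against `C_c^∞` must be tested
against `H¹` (`green`): on the line by localization, mollification and cutoffs; on the torus by
lifting to `ℝ^d` and using a partition of unity made of lattice translates. Second, the Poisson
equation is well posed (`Regular.poissonWellPosed`): Lax–Milgram on a closed subspace of `L² × L²`,
with coercivity from the Poincaré inequality, which survives bounded perturbations of the potential
(`Poincare.perturb`). -/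

lemma gradient_apply (ξ : Sp d → ℝ) (x : Sp d) (i : Fin d) :
    (gradient ξ x) i = fderiv ℝ ξ x (EuclideanSpace.single i 1) := by
  rw [← inner_gradient_left, real_inner_comm, EuclideanSpace.inner_single_left]
  simp

lemma sp_inner_eq_sum (x y : Sp d) : inner ℝ x y = ∑ i, x i * y i := by
  simp [PiLp.inner_apply, mul_comm]

/-- The correlation is the `L²` inner product of `A` with a translate of `F`, and translations act
continuously on `L²`. -/
lemma continuous_correlation {A F : Sp d → ℝ} (hA : MemLp A 2 volume) (hF : MemLp F 2 volume) :
    Continuous fun s : Sp d => ∫ x, A x * F (s + x) := by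
  have : Fact ((2 : ENNReal) ≠ ⊤) := ⟨by simp⟩
  have h : ∀ s : Sp d, ∫ x, A x * F (s + x) =
      inner ℝ (hA.toLp A) ((DomAddAct.mk s : (Sp d)ᵈᵃᵃ) +ᵥ hF.toLp F) := by
    intro s
    rw [L2.inner_def]
    refine integral_congr_ae ?_
    rw [DomAddAct.mk_vadd_toLp]
    filter_upwards [hA.coeFn_toLp,
      (hF.comp_measurePreserving (measurePreserving_vadd s volume)).coeFn_toLp] with x h1 h2
    rw [h1]
    erw [h2]
    simp [mul_comm]
  simp_rw [h]
  have hc : Continuous fun s : Sp d => (DomAddAct.mk s : (Sp d)ᵈᵃᵃ) +ᵥ hF.toLp F := by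
    have : Continuous fun s : Sp d => (DomAddAct.mk s : (Sp d)ᵈᵃᵃ) :=
      DomAddAct.mkHomeomorph.continuous
    exact this.vadd continuous_const
  exact continuous_const.inner hc

/-- By Fubini the mollifier moves onto the correlation of `A` and `F`. That function is continuous,
so the approximate identity converges pointwise at `0`. -/
lemma tendsto_integral_mul_mollify {A F : Sp d → ℝ} (hA : MemLp A 2 volume)
    (hF : MemLp F 2 volume) {η : ℕ → ContDiffBump (0 : Sp d)}
    (hη : Tendsto (fun n => (η n).rOut) atTop (𝓝 0)) :
    Tendsto (fun n => ∫ x, A x * convolution F ((η n).normed volume)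
      (ContinuousLinearMap.mul ℝ ℝ) volume x) atTop (𝓝 (∫ x, A x * F x)) := by
  have hg : Continuous fun s : Sp d => ∫ x, A x * F (s + x) := continuous_correlation hA hF
  have key := ContDiffBump.convolution_tendsto_right_of_continuous (μ := volume) hη hg 0
  simp only [zero_add] at key
  refine key.congr fun n => ?_
  set e := (η n).normed volume with he
  have hei : Integrable e volume := (η n).integrable_normed
  have hA2 : Integrable (fun x => A x ^ 2) volume := hA.integrable_sq
  have hF2 : Integrable (fun x => F x ^ 2) volume := hF.integrable_sq
  have hint : Integrable (Function.uncurry fun x t : Sp d => A x * (e t * F (x - t)))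
      (volume.prod volume) := by
    have h1 : Integrable (fun p : Sp d × Sp d => A p.1 ^ 2 * e p.2) (volume.prod volume) :=
      hA2.mul_prod hei
    have h2 := hei.convolution_integrand (ContinuousLinearMap.mul ℝ ℝ) hF2
    have h3 := hei.aestronglyMeasurable.convolution_integrand (μ := volume)
      (ContinuousLinearMap.mul ℝ ℝ) hF.aestronglyMeasurable
    -- Since `e ≥ 0`, Young's inequality dominates `|A e F|` by `A² e + e F²`.
    refine (h1.add h2).mono' (hA.aestronglyMeasurable.comp_fst.mul h3) ?_
    refine Eventually.of_forall fun p => ?_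
    have he0 : 0 ≤ e p.2 := (η n).nonneg_normed _
    simp only [Function.uncurry, Pi.add_apply, ContinuousLinearMap.mul_apply', Real.norm_eq_abs]
    rw [abs_le]
    constructor <;>
    nlinarith [mul_nonneg he0 (sq_nonneg (A p.1 + F (p.1 - p.2))),
      mul_nonneg he0 (sq_nonneg (A p.1 - F (p.1 - p.2))), mul_nonneg he0 (sq_nonneg (A p.1)),
      mul_nonneg he0 (sq_nonneg (F (p.1 - p.2)))]
  have hswap := integral_integral_swap hint
  have hL : ∀ x, A x * convolution F e (ContinuousLinearMap.mul ℝ ℝ) volume x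
      = ∫ t, A x * (e t * F (x - t)) := by
    intro x
    rw [integral_const_mul, convolution_mul_swap]
    simp_rw [mul_comm]
  simp_rw [hL]
  rw [hswap, convolution_lsmul]
  refine integral_congr_ae (Eventually.of_forall fun t => ?_)
  simp only [smul_eq_mul]
  rw [← integral_const_mul]
  refine integral_congr_ae (Eventually.of_forall fun x => ?_)
  simp only [zero_sub, neg_add_eq_sub]
  ring

/-- Local square integrability on the whole Euclidean space. -/
def L2loc {E : Type*} [NormedAddCommGroup E] (h : Sp d → E) : Prop :=
  ∀ K : Set (Sp d), IsCompact K → MemLp h 2 (volume.restrict K)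

lemma L2loc.locallyIntegrable {E : Type*} [NormedAddCommGroup E] {h : Sp d → E} (hh : L2loc h) :
    LocallyIntegrable h volume := by
  rw [locallyIntegrable_iff]
  intro K hK
  have : IsFiniteMeasure (volume.restrict K) := ⟨by simpa using hK.measure_lt_top⟩
  exact (hh K hK).integrable (by norm_num)

lemma L2loc.coord {h : Sp d → Sp d} (hh : L2loc h) (i : Fin d) : L2loc fun x => h x i :=
  fun K hK => (hh K hK).eval_piLp i

lemma L2loc.continuous_smul {E : Type*} [NormedAddCommGroup E] [NormedSpace ℝ E] {h : Sp d → E}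
    {k : Sp d → ℝ} (hh : L2loc h) (hk : Continuous k) : L2loc fun x => k x • h x := by
  intro K hK
  obtain ⟨C, hC⟩ := hK.exists_bound_of_continuousOn hk.continuousOn
  refine (hh K hK).of_le_mul (c := C) (hk.aestronglyMeasurable.smul (hh K hK).1) ?_
  filter_upwards [ae_restrict_mem hK.measurableSet] with x hx
  rw [norm_smul]
  exact mul_le_mul_of_nonneg_right (hC x hx) (norm_nonneg _)

lemma L2loc.memLp_mul {h χ : Sp d → ℝ} (hh : L2loc h) (hk : Continuous χ)
    (hc : HasCompactSupport χ) : MemLp (fun x => χ x * h x) 2 volume := by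
  have h1 := (hh.continuous_smul hk) _ hc.isCompact
  rw [← memLp_indicator_iff_restrict hc.isCompact.measurableSet] at h1
  refine h1.ae_eq (Eventually.of_forall fun x => ?_)
  by_cases hx : x ∈ tsupport χ
  · simp [hx]
  · simp [hx, image_eq_zero_of_notMem_tsupport hx]

lemma IsTest.partial {ξ : Sp d → ℝ} (h : IsTest Dom.line ξ) (v : Sp d) :
    IsTest Dom.line (fun x => fderiv ℝ ξ x v) :=
  ⟨⟨trivial, (h.smooth.contDiff.fderiv_right (m := ∞) (by simp)).clm_apply contDiff_const⟩,
    fun _ => (h.compact rfl).fderiv_apply ℝ v⟩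

lemma IsTest.mul_line {ξ χ : Sp d → ℝ} (h : IsTest Dom.line ξ) (hχ : ContDiff ℝ ∞ χ) :
    IsTest Dom.line (fun x => χ x * ξ x) :=
  ⟨⟨trivial, hχ.mul h.smooth.contDiff⟩, fun _ => (h.compact rfl).mul_left⟩

lemma fderiv_mul_apply' {ξ χ : Sp d → ℝ} (h : ContDiff ℝ ∞ ξ) (hχ : ContDiff ℝ ∞ χ)
    (x v : Sp d) : fderiv ℝ (fun x => χ x * ξ x) x v =
      χ x * fderiv ℝ ξ x v + fderiv ℝ χ x v * ξ x := by
  have := fderiv_mul (hχ.differentiable (by simp) x) (h.differentiable (by simp) x)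
  erw [this]
  simp [mul_comm]

lemma IsTest.continuous {D : Dom} {ξ : Sp d → ℝ} (h : IsTest D ξ) : Continuous ξ :=
  h.smooth.contDiff.continuous

/-- Derivatives of a mollified function with a weak gradient. -/
lemma fderiv_mollify {u F : Sp d → ℝ} {v : Sp d} (hu : LocallyIntegrable u volume)
    (hw : ∀ ξ : Sp d → ℝ, IsTest Dom.line ξ →
      ∫ x, u x * fderiv ℝ ξ x v = -∫ x, F x * ξ x)
    {e : Sp d → ℝ} (he : IsTest Dom.line e) (x : Sp d) :
    fderiv ℝ (convolution u e (ContinuousLinearMap.mul ℝ ℝ) volume) x v =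
      convolution F e (ContinuousLinearMap.mul ℝ ℝ) volume x := by
  have hec := he.compact rfl
  have hes := he.smooth.contDiff
  rw [(hec.hasFDerivAt_convolution_right (ContinuousLinearMap.mul ℝ ℝ) hu
    (hes.of_le (by simp)) x).fderiv]
  rw [convolution_precompR_apply _ hu (hec.fderiv ℝ) (hes.continuous_fderiv (by simp))]
  have ht : IsTest Dom.line (fun t => e (x - t)) :=
    ⟨⟨trivial, hes.comp (contDiff_const.sub contDiff_id)⟩,
      fun _ => hec.comp_homeomorph (Homeomorph.subLeft x)⟩
  have h := hw _ ht
  have hd : ∀ t, fderiv ℝ (fun t => e (x - t)) t v = - fderiv ℝ e (x - t) v := by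
    intro t
    have h1 : HasFDerivAt (fun t => e (x - t)) ((fderiv ℝ e (x - t)).comp
        (-(ContinuousLinearMap.id ℝ (Sp d)))) t :=
      ((hes.differentiable (by simp) (x - t)).hasFDerivAt).comp t
        ((hasFDerivAt_id t).const_sub x)
    rw [h1.fderiv]; simp
  simp_rw [hd, mul_neg, integral_neg, neg_inj] at h
  rw [convolution_mul, convolution_mul, h]

/-- The weak product rule, for multiplication by a smooth function. -/
lemma weak_mul {ψ H χ : Sp d → ℝ} {v : Sp d} (hψ : LocallyIntegrable ψ volume)
    (hH : LocallyIntegrable H volume)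
    (hw : ∀ ξ : Sp d → ℝ, IsTest Dom.line ξ → ∫ x, ψ x * fderiv ℝ ξ x v = -∫ x, H x * ξ x)
    (hχ : ContDiff ℝ ∞ χ) (ξ : Sp d → ℝ) (hξ : IsTest Dom.line ξ) :
    ∫ x, (χ x * ψ x) * fderiv ℝ ξ x v
      = -∫ x, (χ x * H x + fderiv ℝ χ x v * ψ x) * ξ x := by
  have h := hw _ (hξ.mul_line hχ)
  simp_rw [fderiv_mul_apply' hξ.smooth.contDiff hχ] at h
  have hdχ : Continuous fun x => fderiv ℝ χ x v :=
    (hχ.continuous_fderiv (by simp)).clm_apply continuous_const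
  have i1 : Integrable (fun x => ψ x * (χ x * fderiv ℝ ξ x v)) volume :=
    hψ.integrable_smul_right_of_hasCompactSupport
      (hχ.continuous.mul (hξ.partial v).continuous) ((hξ.partial v).compact rfl).mul_left
  have i2 : Integrable (fun x => ψ x * (fderiv ℝ χ x v * ξ x)) volume :=
    hψ.integrable_smul_right_of_hasCompactSupport
      (hdχ.mul hξ.continuous) (hξ.compact rfl).mul_left
  have i3 : Integrable (fun x => H x * (χ x * ξ x)) volume :=
    hH.integrable_smul_right_of_hasCompactSupport
      (hχ.continuous.mul hξ.continuous) (hξ.compact rfl).mul_left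
  simp_rw [mul_add] at h
  rw [integral_add i1 i2] at h
  have e1 : ∫ x, (χ x * ψ x) * fderiv ℝ ξ x v = ∫ x, ψ x * (χ x * fderiv ℝ ξ x v) := by
    congr 1; ext x; ring
  have e2 : ∫ x, (χ x * H x + fderiv ℝ χ x v * ψ x) * ξ x =
      (∫ x, H x * (χ x * ξ x)) + ∫ x, ψ x * (fderiv ℝ χ x v * ξ x) := by
    rw [← integral_add i3 i2]; congr 1; ext x; ring
  rw [e1, e2]; linarith

/-- A weak equation tested against `C_c^∞(ℝ^d)` can be tested against localized Sobolev
functions. -/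
theorem local_green {ψ : Sp d → ℝ} {H : Sp d → Sp d} (hw : IsWeakGrad Dom.line ψ H)
    (hψ : L2loc ψ) (hH : L2loc H) {A : Sp d → Sp d} {a : Sp d → ℝ} (hA : L2loc A) (ha : L2loc a)
    (heq : ∀ ξ : Sp d → ℝ, IsTest Dom.line ξ →
      ∫ x, inner ℝ (A x) (gradient ξ x) = ∫ x, a x * ξ x)
    {χ : Sp d → ℝ} (hχ : IsTest Dom.line χ) :
    ∫ x, χ x * inner ℝ (A x) (H x) + ψ x * inner ℝ (A x) (gradient χ x)
      = ∫ x, χ x * (a x * ψ x) := by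
  set b : Fin d → Sp d := fun i => EuclideanSpace.single i 1 with hb
  -- The localized function `u = χψ` has weak gradient `F`; the equation is tested against
  -- mollifications of `u`, whose partial derivatives are mollifications of `F`.
  set u : Sp d → ℝ := fun x => χ x * ψ x with hu
  set F : Fin d → Sp d → ℝ := fun i x => χ x * H x i + fderiv ℝ χ x (b i) * ψ x with hF
  have hχs := hχ.smooth.contDiff
  have hχc := hχ.compact rfl
  have huL : MemLp u 2 volume := hψ.memLp_mul hχ.continuous hχc
  have hFL : ∀ i, MemLp (F i) 2 volume := fun i =>
    ((hH.coord i).memLp_mul hχ.continuous hχc).add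
      (hψ.memLp_mul (hχ.partial (b i)).continuous ((hχ.partial (b i)).compact rfl))
  have hwk : ∀ i, ∀ ξ : Sp d → ℝ, IsTest Dom.line ξ →
      ∫ x, u x * fderiv ℝ ξ x (b i) = -∫ x, F i x * ξ x := by
    intro i ξ hξ
    refine weak_mul hψ.locallyIntegrable (hH.coord i).locallyIntegrable ?_ hχs ξ hξ
    intro ξ hξ
    have := hw.parts ξ hξ i
    simpa only [gradient_apply, vol] using this
  obtain ⟨R, hR⟩ := hχc.isCompact.isBounded.subset_closedBall (0 : Sp d)
  -- Mollifiers of radius at most 1 keep every support in this ball, so `A` and `a` may be cut off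
  -- to `K`, which makes them globally `L²`.
  set K := Metric.closedBall (0 : Sp d) (R + 1) with hK
  have hKc : IsCompact K := isCompact_closedBall _ _
  set η : ℕ → ContDiffBump (0 : Sp d) := fun n =>
    ⟨1 / (n + 2) / 2, 1 / (n + 2), by positivity, by
      have : (0 : ℝ) < 1 / (n + 2) := by positivity
      linarith⟩ with hη
  have hηt : Tendsto (fun n => (η n).rOut) atTop (𝓝 0) := by
    have h1 := (tendsto_one_div_add_atTop_nhds_zero_nat (𝕜 := ℝ)).comp (tendsto_add_atTop_nat 1)
    refine h1.congr fun n => ?_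
    simp [hη]; ring
  have hη1 : ∀ n, (η n).rOut ≤ 1 := by
    intro n
    simp only [hη]
    rw [div_le_one (by positivity)]
    have : (0 : ℝ) ≤ n := n.cast_nonneg
    linarith
  set e : ℕ → Sp d → ℝ := fun n => (η n).normed volume with he
  have het : ∀ n, IsTest Dom.line (e n) := fun n =>
    ⟨⟨trivial, (η n).contDiff_normed⟩, fun _ => (η n).hasCompactSupport_normed⟩
  set ξ : ℕ → Sp d → ℝ := fun n => convolution u (e n) (ContinuousLinearMap.mul ℝ ℝ) volume with hξ
  have huloc : LocallyIntegrable u volume := huL.locallyIntegrable (by norm_num)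
  have hucs : HasCompactSupport u := hχc.mul_right
  have hξt : ∀ n, IsTest Dom.line (ξ n) := fun n =>
    ⟨⟨trivial, ((het n).compact rfl).contDiff_convolution_right (n := ⊤) _ huloc
      (het n).smooth.contDiff⟩, fun _ => hucs.convolution _ ((het n).compact rfl)⟩
  have hξd : ∀ n i x, fderiv ℝ (ξ n) x (b i) =
      convolution (F i) (e n) (ContinuousLinearMap.mul ℝ ℝ) volume x := fun n i x =>
    fderiv_mollify huloc (hwk i) (het n) x
  have hsupp : ∀ n, tsupport (ξ n) ⊆ K := by
    intro n
    refine closure_minimal ?_ Metric.isClosed_closedBall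
    refine (support_convolution_subset _).trans ?_
    rintro x ⟨y, hy, z, hz, rfl⟩
    have h1 : y ∈ tsupport χ := subset_closure (left_ne_zero_of_mul hy)
    have h2 := hR h1
    rw [(η n).support_normed_eq] at hz
    have h3 := hη1 n
    simp only [hK, mem_closedBall_zero_iff, mem_ball_zero_iff] at *
    linarith [norm_add_le y z]
  have hAK : ∀ i, MemLp (K.indicator fun x => A x i) 2 volume := fun i => by
    rw [memLp_indicator_iff_restrict hKc.measurableSet]
    exact hA.coord i K hKc
  have haK : MemLp (K.indicator a) 2 volume := by
    rw [memLp_indicator_iff_restrict hKc.measurableSet]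
    exact ha K hKc
  have hl : ∀ i, Tendsto (fun n => ∫ x, K.indicator (fun x => A x i) x * convolution (F i) (e n)
      (ContinuousLinearMap.mul ℝ ℝ) volume x) atTop
      (𝓝 (∫ x, K.indicator (fun x => A x i) x * F i x)) := fun i =>
    tendsto_integral_mul_mollify (hAK i) (hFL i) hηt
  have hr : Tendsto (fun n => ∫ x, K.indicator a x * ξ n x) atTop
      (𝓝 (∫ x, K.indicator a x * u x)) := tendsto_integral_mul_mollify haK huL hηt
  have hsum := tendsto_finsetSum Finset.univ fun i _ => hl i
  have hEq : ∀ n, ∑ i, ∫ x, K.indicator (fun x => A x i) x * convolution (F i) (e n)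
      (ContinuousLinearMap.mul ℝ ℝ) volume x = ∫ x, K.indicator a x * ξ n x := by
    intro n
    have h := heq _ (hξt n)
    have hLL : ∀ x, inner ℝ (A x) (gradient (ξ n) x) = ∑ i, K.indicator (fun x => A x i) x *
        convolution (F i) (e n) (ContinuousLinearMap.mul ℝ ℝ) volume x := by
      intro x
      rw [sp_inner_eq_sum]
      refine Finset.sum_congr rfl fun i _ => ?_
      rw [gradient_apply, ← hξd n i x]
      by_cases hx : x ∈ K
      · rw [Set.indicator_of_mem hx]
      · have : fderiv ℝ (ξ n) x = 0 :=
          image_eq_zero_of_notMem_tsupport fun h' => hx (hsupp n (tsupport_fderiv_subset ℝ h'))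
        erw [this]; simp
    have hRR : ∀ x, a x * ξ n x = K.indicator a x * ξ n x := by
      intro x
      by_cases hx : x ∈ K
      · rw [Set.indicator_of_mem hx]
      · rw [image_eq_zero_of_notMem_tsupport fun h' => hx (hsupp n h')]; simp
    simp_rw [hLL, hRR] at h
    rw [integral_finsetSum] at h
    · exact h
    · intro i _
      have hc : Continuous fun x => fderiv ℝ (ξ n) x (b i) := ((hξt n).partial (b i)).continuous
      have hcs := ((hξt n).partial (b i)).compact rfl
      have hI := ((hAK i).locallyIntegrable (by norm_num)).integrable_smul_right_of_hasCompactSupport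
        hc hcs
      simpa only [hξd, smul_eq_mul] using hI
  have hlim := tendsto_nhds_unique (hsum.congr hEq) hr
  have hin : ∀ x ∉ K, χ x = 0 ∧ ∀ i, F i x = 0 := by
    intro x hx
    have hx' : x ∉ tsupport χ := fun h => hx (by
      have := hR h
      simp only [hK, mem_closedBall_zero_iff] at *
      linarith)
    have h1 := image_eq_zero_of_notMem_tsupport hx'
    have h2 : fderiv ℝ χ x = 0 :=
      image_eq_zero_of_notMem_tsupport fun h' => hx' (tsupport_fderiv_subset ℝ h')
    refine ⟨h1, fun i => ?_⟩
    simp [hF, h1, h2]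
  rw [← integral_finsetSum] at hlim
  · convert hlim using 1
    · congr 1; ext x
      have : ∀ i, K.indicator (fun x => A x i) x * F i x = A x i * F i x := by
        intro i
        by_cases hx : x ∈ K
        · rw [Set.indicator_of_mem hx]
        · simp [(hin x hx).2 i]
      simp_rw [this, sp_inner_eq_sum, gradient_apply, hF, Finset.mul_sum]
      rw [← Finset.sum_add_distrib]
      refine Finset.sum_congr rfl fun i _ => ?_
      ring
    · congr 1; ext x
      by_cases hx : x ∈ K
      · rw [Set.indicator_of_mem hx]; simp only [hu]; ring
      · simp [hu, (hin x hx).1]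
  · intro i _
    exact (hAK i).integrable_mul (hFL i)

/-! ### Periodic functions and periodization -/

/-- The lattice `(2πℤ)^d`. -/
def perLattice (d : ℕ) : AddSubgroup (Sp d) :=
  AddMonoidHom.range
    { toFun := fun k : Fin d → ℤ => (WithLp.toLp 2 fun i => (k i : ℝ) * (2 * Real.pi) : Sp d)
      map_zero' := by ext i; simp
      map_add' := fun a b => by ext i; simp [add_mul] }

instance : Countable (perLattice d) :=
  (AddMonoidHom.rangeRestrict_surjective _).countable

lemma mem_perLattice {l : Sp d} :
    l ∈ perLattice d ↔ ∃ k : Fin d → ℤ, ∀ i, l i = k i * (2 * Real.pi) := by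
  constructor
  · rintro ⟨k, rfl⟩
    exact ⟨k, fun i => rfl⟩
  · rintro ⟨k, hk⟩
    exact ⟨k, by ext i; simp [hk]⟩

/-- The periods of `g` form a subgroup, and the coordinate periods generate the lattice. -/
lemma IsOn.add_left {α : Type} {g : Sp d → α} (hg : IsOn Dom.torus g) {l : Sp d}
    (hl : l ∈ perLattice d) (x : Sp d) : g (l + x) = g x := by
  let S : AddSubgroup (Sp d) :=
    { carrier := {v | ∀ x, g (x + v) = g x}
      zero_mem' := fun x => by simp
      add_mem' := fun {a b} ha hb x => by rw [← add_assoc, hb, ha]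
      neg_mem' := fun {a} ha x => by rw [← ha (x + -a), neg_add_cancel_right] }
  obtain ⟨k, hk⟩ := mem_perLattice.1 hl
  have : l = ∑ i, k i • EuclideanSpace.single i (2 * Real.pi) := by
    ext j
    simp [hk, Finset.sum_apply, Pi.single_apply]
  have hS : l ∈ S := by
    rw [this]
    exact sum_mem fun i _ => S.zsmul_mem (fun x => hg i x) _
  rw [add_comm]
  exact hS x

lemma isOn_torus_of_add_left {α : Type} {g : Sp d → α}
    (hg : ∀ l ∈ perLattice d, ∀ x, g (l + x) = g x) : IsOn Dom.torus g := by
  intro i x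
  rw [add_comm]
  refine hg _ (mem_perLattice.2 ⟨Pi.single i 1, fun j => ?_⟩) x
  by_cases h : j = i
  · subst h; simp
  · simp [h]

/-- The cube of side `2π` centered at `c`. -/
def cell (c : Sp d) : Set (Sp d) := {x | ∀ i, x i ∈ Set.Ioc (c i - Real.pi) (c i + Real.pi)}

lemma vol_torus (d : ℕ) : vol Dom.torus d = volume.restrict (cell 0) := by
  simp [vol, cell]

lemma measurableSet_cell (c : Sp d) : MeasurableSet (cell c) := by
  have : cell c = ⋂ i, (fun x : Sp d => x i) ⁻¹' Set.Ioc (c i - Real.pi) (c i + Real.pi) := by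
    ext x; simp [cell]
  rw [this]
  exact MeasurableSet.iInter fun i =>
    (EuclideanSpace.proj (𝕜 := ℝ) i).continuous.measurable measurableSet_Ioc

lemma existsUnique_add_mem_cell (c x : Sp d) : ∃! l : perLattice d, (l : Sp d) + x ∈ cell c := by
  have hp : (0 : ℝ) < 2 * Real.pi := by positivity
  have h := fun i => existsUnique_add_zsmul_mem_Ioc hp (x i) (c i - Real.pi)
  choose k hk hku using h
  have hend : ∀ i, c i - Real.pi + 2 * Real.pi = c i + Real.pi := fun i => by ring
  refine ⟨⟨WithLp.toLp 2 fun i => (k i : ℝ) * (2 * Real.pi), mem_perLattice.2 ⟨k, fun i => rfl⟩⟩,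
    fun i => ?_, ?_⟩
  · have := hk i
    simp only [hend, zsmul_eq_mul] at this
    simpa [add_comm] using this
  · rintro ⟨l, hl⟩ hlc
    obtain ⟨m, hm⟩ := mem_perLattice.1 hl
    ext i
    have := hku i (m i) (by
      have := hlc i
      simp only [hend, zsmul_eq_mul]
      simpa [hm, add_comm] using this)
    simp [hm, this]

lemma isAddFundamentalDomain_cell (c : Sp d) :
    IsAddFundamentalDomain (perLattice d) (cell c) volume :=
  .mk' (measurableSet_cell c).nullMeasurableSet fun x => existsUnique_add_mem_cell c x

lemma cell_subset_closedBall : cell (0 : Sp d) ⊆ Metric.closedBall 0 (Real.pi * √d) := by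
  intro x hx
  rw [mem_closedBall_zero_iff, EuclideanSpace.norm_eq]
  have h : ∑ i, ‖x i‖ ^ 2 ≤ ∑ _i : Fin d, Real.pi ^ 2 := by
    refine Finset.sum_le_sum fun i _ => ?_
    have := hx i
    simp only [PiLp.zero_apply, zero_sub, zero_add, Set.mem_Ioc] at this
    rw [Real.norm_eq_abs, sq_abs]
    nlinarith
  refine (Real.sqrt_le_sqrt h).trans ?_
  simp only [Finset.sum_const, Finset.card_univ, Fintype.card_fin, nsmul_eq_mul]
  rw [mul_comm, Real.sqrt_mul (by positivity), Real.sqrt_sq Real.pi_pos.le]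

lemma cell_mem_nhds (c : Sp d) : cell c ∈ 𝓝 c := by
  have : (⋂ i, (fun x : Sp d => x i) ⁻¹' Set.Ioo (c i - Real.pi) (c i + Real.pi)) ∈ 𝓝 c := by
    refine (Filter.iInter_mem).2 fun i => ?_
    refine (EuclideanSpace.proj (𝕜 := ℝ) i).continuous.continuousAt.preimage_mem_nhds ?_
    exact Ioo_mem_nhds (by simp [Real.pi_pos]) (by simp [Real.pi_pos])
  refine mem_of_superset this fun x hx i => ?_
  exact Set.Ioo_subset_Ioc_self (Set.mem_iInter.1 hx i)

instance : IsFiniteMeasure (vol Dom.torus d) := by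
  rw [vol_torus]
  exact ⟨by simpa using (measure_mono cell_subset_closedBall).trans_lt measure_closedBall_lt_top⟩

section
variable {E : Type} [NormedAddCommGroup E]

/-- Every point `c` is interior to the cell centred at `c`, which is a fundamental domain like the
reference cell, so integrability transfers between the two. -/
lemma IsOn.locallyIntegrable_of_integrable {q : Sp d → E} (hq : IsOn Dom.torus q)
    (hi : Integrable q (vol Dom.torus d)) : LocallyIntegrable q volume := by
  intro c
  refine ⟨cell c, cell_mem_nhds c, ?_⟩
  rw [vol_torus] at hi
  exact ((isAddFundamentalDomain_cell c).integrableOn_iff (isAddFundamentalDomain_cell 0)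
    (fun g x => hq.add_left g.2 x)).2 hi

lemma integrable_torus {q : Sp d → E} (hi : LocallyIntegrable q (vol Dom.torus d)) :
    Integrable q (vol Dom.torus d) := by
  have h := hi.integrableOn_isCompact (isCompact_closedBall (0 : Sp d) (Real.pi * √d))
  rw [vol_torus] at h ⊢
  rwa [IntegrableOn, Measure.restrict_restrict measurableSet_closedBall,
    Set.inter_eq_right.2 cell_subset_closedBall] at h

lemma IsOn.l2loc {q : Sp d → E} (hq : IsOn Dom.torus q)
    (hi : MemLp q 2 (vol Dom.torus d)) : L2loc q := by
  have h1 := hq.locallyIntegrable_of_integrable (hi.integrable (by norm_num))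
  have h2 : LocallyIntegrable (fun x => ‖q x‖ ^ 2) volume :=
    IsOn.locallyIntegrable_of_integrable (fun i x => by simp only [hq i x]) hi.integrable_norm_pow'
  intro K hK
  rw [memLp_two_iff_integrable_sq_norm h1.aestronglyMeasurable.restrict]
  exact h2.integrableOn_isCompact hK

end

/-! ### Lattice sums of compactly supported functions. -/

lemma finite_perLattice (M : ℝ) : {l : perLattice d | ‖(l : Sp d)‖ ≤ M}.Finite := by
  obtain ⟨N, hN⟩ := exists_nat_ge M
  have hfin : (Set.Icc (fun _ : Fin d => -(N : ℤ)) (fun _ => (N : ℤ))).Finite := Set.finite_Icc _ _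
  refine Set.Finite.of_finite_image ((hfin.image fun k : Fin d → ℤ =>
    (WithLp.toLp 2 fun i => (k i : ℝ) * (2 * Real.pi) : Sp d)).subset ?_)
    Subtype.val_injective.injOn
  rintro _ ⟨⟨l, hl⟩, hM, rfl⟩
  obtain ⟨k, hk⟩ := mem_perLattice.1 hl
  refine ⟨k, ?_, by ext i; simp [hk]⟩
  have hki : ∀ i, |(k i : ℝ)| ≤ N := by
    intro i
    have h1 : ‖l i‖ ≤ N := ((PiLp.norm_apply_le l i).trans hM).trans hN
    rw [hk, Real.norm_eq_abs, abs_mul, abs_of_pos (by positivity : (0 : ℝ) < 2 * Real.pi)] at h1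
    nlinarith [Real.pi_gt_three, abs_nonneg (k i : ℝ)]
  constructor <;> intro i <;> have := abs_le.1 (hki i)
  · have h := this.1; simp only; exact_mod_cast h
  · have h := this.2; simp only; exact_mod_cast h

/-- The periodization of a compactly supported function. -/
def perSum (h : Sp d → ℝ) (x : Sp d) : ℝ := ∑ᶠ l : perLattice d, h (l + x)

lemma isOn_perSum (h : Sp d → ℝ) : IsOn Dom.torus (perSum h) := by
  refine isOn_torus_of_add_left fun l hl x => ?_
  unfold perSum
  refine Eq.trans ?_ (finsum_comp_equiv (Equiv.addRight (⟨l, hl⟩ : perLattice d)))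
  simp [add_assoc]

/-- Local finiteness: one finite set of translates serves a whole ball, so that periodizations are
locally finite sums. -/
lemma exists_finset_perLattice {h : Sp d → ℝ} (hc : HasCompactSupport h) (M : ℝ) :
    ∃ F : Finset (perLattice d), ∀ x : Sp d, ‖x‖ ≤ M → ∀ l ∉ F, h (l + x) = 0 := by
  obtain ⟨R, hR⟩ := hc.isCompact.isBounded.subset_closedBall (0 : Sp d)
  refine ⟨(finite_perLattice (R + M)).toFinset, fun x hx l hl => ?_⟩
  by_contra hne
  refine hl ?_
  have h1 := hR (subset_tsupport h hne)
  simp only [Set.Finite.mem_toFinset, Set.mem_ofPred_eq, mem_closedBall_zero_iff] at *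
  have := norm_sub_le ((l : Sp d) + x) x
  rw [add_sub_cancel_right] at this
  linarith

lemma perSum_eq_sum {h : Sp d → ℝ} {F : Finset (perLattice d)} {x : Sp d}
    (hF : ∀ l ∉ F, h (l + x) = 0) : perSum h x = ∑ l ∈ F, h (l + x) :=
  finsum_eq_sum_of_support_subset _ fun l hl => by
    by_contra hn
    exact hl (hF l hn)

lemma perSum_eventuallyEq {h : Sp d → ℝ} (hc : HasCompactSupport h) (x : Sp d) :
    ∃ F : Finset (perLattice d), perSum h =ᶠ[𝓝 x] fun y => ∑ l ∈ F, h (l + y) := by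
  obtain ⟨F, hF⟩ := exists_finset_perLattice hc (‖x‖ + 1)
  refine ⟨F, ?_⟩
  filter_upwards [Metric.ball_mem_nhds x one_pos] with y hy
  refine perSum_eq_sum (hF y ?_)
  have := norm_sub_norm_le y x
  rw [mem_ball_iff_norm] at hy
  linarith

lemma IsTest.perSum {ξ : Sp d → ℝ} (hξ : IsTest Dom.line ξ) : IsTest Dom.torus (perSum ξ) := by
  refine ⟨⟨isOn_perSum ξ, contDiff_iff_contDiffAt.2 fun x => ?_⟩, fun h => by cases h⟩
  obtain ⟨F, hF⟩ := perSum_eventuallyEq (hξ.compact rfl) x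
  refine ContDiffAt.congr_of_eventuallyEq ?_ hF
  exact (ContDiff.sum fun l _ =>
    hξ.smooth.contDiff.comp (contDiff_const.add contDiff_id)).contDiffAt

lemma fderiv_perSum {ξ : Sp d → ℝ} (hξ : IsTest Dom.line ξ) (x v : Sp d) :
    fderiv ℝ (perSum ξ) x v = perSum (fun y => fderiv ℝ ξ y v) x := by
  -- The margin 1 makes `F` valid near `x`: omitted translates vanish on a neighbourhood, hence so
  -- do their derivatives at `x`.
  obtain ⟨F, hF⟩ := exists_finset_perLattice (hξ.compact rfl) (‖x‖ + 1)
  have hev : perSum ξ =ᶠ[𝓝 x] fun y => ∑ l ∈ F, ξ (l + y) := by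
    filter_upwards [Metric.ball_mem_nhds x one_pos] with y hy
    refine perSum_eq_sum (hF y ?_)
    have := norm_sub_norm_le y x
    rw [mem_ball_iff_norm] at hy
    linarith
  have hl : ∀ l ∉ F, fderiv ℝ ξ ((l : Sp d) + x) v = 0 := by
    intro l hlF
    have h0 : (fun y => ξ ((l : Sp d) + y)) =ᶠ[𝓝 x] fun _ => 0 := by
      filter_upwards [Metric.ball_mem_nhds x one_pos] with y hy
      refine hF y ?_ l hlF
      have := norm_sub_norm_le y x
      rw [mem_ball_iff_norm] at hy
      linarith
    have h1 := h0.fderiv_eq (𝕜 := ℝ)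
    rw [fderiv_comp_add_left] at h1
    simp [h1]
  rw [hev.fderiv_eq, perSum_eq_sum hl, fderiv_fun_sum]
  · simp [fderiv_comp_add_left]
  · intro l _
    exact (hξ.smooth.contDiff.differentiable (by simp) _).comp x
      (differentiableAt_id.const_add _)

/-- Unfolding an integral over the whole space of a periodic function against a compactly
supported one. -/
lemma integral_mul_perSum {φ h : Sp d → ℝ} (hφ : IsOn Dom.torus φ)
    (hi : Integrable φ (vol Dom.torus d)) (hh : Continuous h) (hc : HasCompactSupport h) :
    ∫ x, φ x * perSum h x ∂(vol Dom.torus d) = ∫ x, φ x * h x := by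
  have hloc := hφ.locallyIntegrable_of_integrable hi
  have hint : Integrable (fun x => φ x * h x) volume :=
    hloc.integrable_smul_right_of_hasCompactSupport hh hc
  obtain ⟨F, hF⟩ := exists_finset_perLattice hc (Real.pi * √d)
  have hF' : ∀ x ∈ cell (0 : Sp d), ∀ l ∉ F, h ((l : Sp d) + x) = 0 := fun x hx =>
    hF x (mem_closedBall_zero_iff.1 (cell_subset_closedBall hx))
  -- The whole-space integral splits over the lattice translates of the cell; periodicity of `φ`
  -- lets it factor out of each term.
  have hts := (isAddFundamentalDomain_cell (0 : Sp d)).integral_eq_tsum'' _ hint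
  have hv : ∀ (l : perLattice d) (x : Sp d), l +ᵥ x = (l : Sp d) + x := fun l x => rfl
  simp only [hv, hφ.add_left (Subtype.prop _)] at hts
  rw [hts, tsum_eq_sum (s := F), vol_torus, ← integral_finsetSum]
  · refine setIntegral_congr_fun (measurableSet_cell 0) fun x hx => ?_
    rw [perSum_eq_sum (hF' x hx), Finset.mul_sum]
  · intro l _
    have : Integrable (fun x => φ x * h (l + x)) volume :=
      hloc.integrable_smul_right_of_hasCompactSupport (hh.comp (continuous_const.add continuous_id))
        (hc.comp_homeomorph (Homeomorph.addLeft (l : Sp d)))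
    exact this.integrableOn
  · intro l hl
    rw [setIntegral_congr_fun (g := fun _ => (0 : ℝ)) (measurableSet_cell 0)
      fun x hx => by simp [hF' x hx l hl], integral_zero]

lemma perSum_mul {q h : Sp d → ℝ} (hq : IsOn Dom.torus q) (hc : HasCompactSupport h) (x : Sp d) :
    perSum (fun y => q y * h y) x = q x * perSum h x := by
  obtain ⟨F, hF⟩ := exists_finset_perLattice hc ‖x‖
  rw [perSum_eq_sum (hF x le_rfl), perSum_eq_sum (F := F), Finset.mul_sum]
  · simp only [hq.add_left (Subtype.prop _)]
  · intro l hl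
    rw [hF x le_rfl l hl, mul_zero]

/-- A smooth partition of unity made of the lattice translates of one function. -/
lemma exists_perSum_eq_one (d : ℕ) : ∃ χ : Sp d → ℝ, IsTest Dom.line χ ∧ ∀ x, perSum χ x = 1 := by
  -- The inner ball contains the cell, so each point has a translate where `b = 1` and the
  -- periodization is positive. Dividing by this periodic function normalizes the sum to 1.
  let b : ContDiffBump (0 : Sp d) := ⟨Real.pi * √d + 1, Real.pi * √d + 2, by positivity, by linarith⟩
  have hb : IsTest Dom.line b := ⟨⟨trivial, b.contDiff⟩, fun _ => b.hasCompactSupport⟩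
  have hpos : ∀ x, 0 < perSum b x := by
    intro x
    obtain ⟨l, hl, -⟩ := existsUnique_add_mem_cell 0 x
    obtain ⟨F, hF⟩ := exists_finset_perLattice (hb.compact rfl) ‖x‖
    rw [perSum_eq_sum (hF x le_rfl)]
    have h1 : b ((l : Sp d) + x) = 1 := b.one_of_mem_closedBall
      (Metric.closedBall_subset_closedBall (by linarith : Real.pi * √d ≤ Real.pi * √d + 1)
        (cell_subset_closedBall hl))
    have hlF : l ∈ F := by
      by_contra h
      have := hF x le_rfl l h
      linarith
    exact Finset.sum_pos' (fun _ _ => b.nonneg) ⟨l, hlF, by rw [h1]; exact one_pos⟩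
  have hs := hb.perSum
  have hinv : ContDiff ℝ ∞ fun x => (perSum b x)⁻¹ := hs.smooth.contDiff.inv fun x => (hpos x).ne'
  refine ⟨fun x => (perSum b x)⁻¹ * b x, hb.mul_line hinv, fun x => ?_⟩
  rw [perSum_mul (fun i x => by simp only [isOn_perSum b i x]) (hb.compact rfl)]
  exact inv_mul_cancel₀ (hpos x).ne'

lemma perSum_partial_eq_zero {χ : Sp d → ℝ} (hχ : IsTest Dom.line χ) (h1 : ∀ x, perSum χ x = 1)
    (v x : Sp d) : perSum (fun y => fderiv ℝ χ y v) x = 0 := by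
  rw [← fderiv_perSum hχ, show perSum χ = fun _ => 1 from funext h1]
  simp

/-! ### Integration by parts on the torus, and passage to the whole space. -/

lemma IsOn.fderiv {ζ : Sp d → ℝ} (h : IsOn Dom.torus ζ) : IsOn Dom.torus (fderiv ℝ ζ) := by
  intro i x
  rw [← fderiv_comp_add_right, show (fun y => ζ (y + _)) = ζ from funext (h i)]

lemma IsOn.gradient {D : Dom} {ζ : Sp d → ℝ} (h : IsOn D ζ) : IsOn D (gradient ζ) := by
  cases D with
  | line => trivial
  | torus =>
    intro i x
    simp only [_root_.gradient, h.fderiv i x]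

lemma integrable_torus_of_continuous {E : Type} [NormedAddCommGroup E] {q : Sp d → E}
    (hq : Continuous q) : Integrable q (vol Dom.torus d) :=
  integrable_torus (by
    rw [vol_torus]; exact fun x => (hq.locallyIntegrable (μ := volume) x).imp
      fun s hs => ⟨hs.1, hs.2.mono_measure Measure.restrict_le_self⟩)

/-- Periodic functions have derivatives of mean zero. -/
lemma integral_fderiv_torus {ζ : Sp d → ℝ} (h : IsTest Dom.torus ζ) (v : Sp d) :
    ∫ x, fderiv ℝ ζ x v ∂(vol Dom.torus d) = 0 := by
  obtain ⟨χ, hχ, h1⟩ := exists_perSum_eq_one d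
  have hζ := h.smooth.contDiff
  have hdζ : Continuous fun x => fderiv ℝ ζ x v :=
    (hζ.continuous_fderiv (by simp)).clm_apply continuous_const
  have hc := hχ.compact rfl
  have hχs := hχ.smooth.contDiff
  have hdχ : Continuous fun x => fderiv ℝ χ x v := (hχ.partial v).continuous
  have hdc := (hχ.partial v).compact rfl
  -- Unfolding with `perSum χ = 1` replaces the cell integral of `∂ζ` by `∫ χ ∂ζ` over `ℝ^d`; by
  -- parts this is `-∫ ζ ∂χ`, which folds back to zero because the translates of `∂χ` sum to zero.
  have e1 := integral_mul_perSum (φ := fun x => fderiv ℝ ζ x v)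
    (fun i x => by simp only [h.smooth.isOn.fderiv i x]) (integrable_torus_of_continuous hdζ)
    hχ.continuous hc
  have e2 := integral_mul_perSum h.smooth.isOn (integrable_torus_of_continuous h.continuous) hdχ hdc
  simp only [h1, perSum_partial_eq_zero hχ h1, mul_one, mul_zero, integral_zero] at e1 e2
  rw [e1]
  have := integral_mul_fderiv_eq_neg_fderiv_mul_of_integrable (μ := (volume : Measure (Sp d)))
    (f := ζ) (g := χ) (v := v)
    ((hdζ.mul hχ.continuous).integrable_of_hasCompactSupport hc.mul_left)
    ((h.continuous.mul hdχ).integrable_of_hasCompactSupport hdc.mul_left)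
    ((h.continuous.mul hχ.continuous).integrable_of_hasCompactSupport hc.mul_left)
    (fun x _ => hζ.differentiable (by simp) x) (fun x _ => hχs.differentiable (by simp) x)
  linarith

/-- On the torus, a compactly supported test function is periodized into an admissible one, and both
sides then unfold. The torus can thus reuse the local argument on `ℝ^d`. -/
lemma IsWeakGrad.to_line {D : Dom} {φ : Sp d → ℝ} {G : Sp d → Sp d} (h : IsWeakGrad D φ G) :
    IsWeakGrad Dom.line φ G := by
  cases D with
  | line => exact h
  | torus =>
    have hφ := integrable_torus h.locInt_fun
    have hG := integrable_torus h.locInt_grad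
    refine ⟨trivial, trivial, h.isOn_fun.locallyIntegrable_of_integrable hφ,
      h.isOn_grad.locallyIntegrable_of_integrable hG, fun ξ hξ i => ?_⟩
    have hp := h.parts _ hξ.perSum i
    simp only [gradient_apply, fderiv_perSum hξ] at hp ⊢
    have hp' := hξ.partial (EuclideanSpace.single i 1)
    rw [integral_mul_perSum h.isOn_fun hφ hp'.continuous (hp'.compact rfl),
      integral_mul_perSum (φ := fun x => G x i) (fun j x => by simp only [h.isOn_grad j x])
        (hG.eval_piLp i) hξ.continuous (hξ.compact rfl)] at hp
    exact hp

/-! ### Gibbs measures -/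

instance (D : Dom) : NeZero (vol D d) := by
  cases D with
  | line => exact inferInstanceAs (NeZero (volume : Measure (Sp d)))
  | torus =>
    rw [vol_torus]
    refine ⟨fun h => ?_⟩
    have := (isAddFundamentalDomain_cell (0 : Sp d)).measure_ne_zero
      (NeZero.ne (volume : Measure (Sp d)))
    exact this (by simpa using h)

instance (D : Dom) : IsLocallyFiniteMeasure (vol D d) := by
  cases D with
  | line => exact inferInstanceAs (IsLocallyFiniteMeasure (volume : Measure (Sp d)))
  | torus => infer_instance

/-- A smooth potential with an integrable Gibbs weight. -/
structure IsPot (D : Dom) (W : Sp d → ℝ) : Prop where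
  smooth : IsSmooth D W
  integrable : Integrable (fun x => Real.exp (-W x)) (vol D d)

/-- The density of the Gibbs measure. -/
def dens (D : Dom) (W : Sp d → ℝ) (x : Sp d) : ℝ := Real.exp (-W x) / Zc D W

namespace IsPot

variable {D : Dom} {W : Sp d → ℝ}

lemma Zc_pos (hW : IsPot D W) : 0 < Zc D W := integral_exp_pos hW.integrable

lemma dens_pos (hW : IsPot D W) (x : Sp d) : 0 < dens D W x := div_pos (Real.exp_pos _) hW.Zc_pos

lemma contDiff_dens (hW : IsPot D W) : ContDiff ℝ ∞ (dens D W) :=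
  (Real.contDiff_exp.comp hW.smooth.contDiff.neg).div_const _

lemma continuous_dens (hW : IsPot D W) : Continuous (dens D W) := hW.contDiff_dens.continuous

lemma isOn_dens (hW : IsPot D W) : IsOn D (dens D W) := by
  cases D with
  | line => trivial
  | torus => intro i x; simp only [dens, hW.smooth.isOn i x]

lemma integral_gibbs (hW : IsPot D W) {E : Type} [NormedAddCommGroup E] [NormedSpace ℝ E] (h : Sp d → E) :
    ∫ x, h x ∂(gibbs D W) = ∫ x, dens D W x • h x ∂(vol D d) := by
  rw [gibbs, integral_withDensity_eq_integral_toReal_smul]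
  · refine integral_congr_ae (Eventually.of_forall fun x => ?_)
    exact congrArg (· • h x) (ENNReal.toReal_ofReal (hW.dens_pos x).le)
  · exact hW.continuous_dens.measurable.ennreal_ofReal
  · exact Eventually.of_forall fun x => ENNReal.ofReal_lt_top

lemma integrable_gibbs_iff (hW : IsPot D W) {E : Type} [NormedAddCommGroup E] [NormedSpace ℝ E] {h : Sp d → E} :
    Integrable h (gibbs D W) ↔ Integrable (fun x => dens D W x • h x) (vol D d) := by
  rw [gibbs, integrable_withDensity_iff_integrable_smul']
  · refine integrable_congr (Eventually.of_forall fun x => ?_)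
    exact congrArg (· • h x) (ENNReal.toReal_ofReal (hW.dens_pos x).le)
  · exact hW.continuous_dens.measurable.ennreal_ofReal
  · exact Eventually.of_forall fun x => ENNReal.ofReal_lt_top

lemma isProbabilityMeasure (hW : IsPot D W) : IsProbabilityMeasure (gibbs D W) := by
  constructor
  have h1 : Integrable (dens D W) (vol D d) := hW.integrable.div_const _
  rw [gibbs, withDensity_apply _ MeasurableSet.univ, Measure.restrict_univ]
  change ∫⁻ x, ENNReal.ofReal (dens D W x) ∂(vol D d) = 1
  rw [← ofReal_integral_eq_lintegral_ofReal h1 (Eventually.of_forall fun x => (hW.dens_pos x).le)]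
  have : ∫ x, dens D W x ∂(vol D d) = 1 := by
    simp only [dens]
    rw [integral_div]
    exact div_self hW.Zc_pos.ne'
  rw [this, ENNReal.ofReal_one]

lemma gibbs_ac (_ : IsPot D W) : gibbs D W ≪ vol D d := withDensity_absolutelyContinuous _ _

lemma vol_ac (hW : IsPot D W) : vol D d ≪ gibbs D W :=
  withDensity_absolutelyContinuous' hW.continuous_dens.measurable.ennreal_ofReal.aemeasurable
    (Eventually.of_forall fun x => (ENNReal.ofReal_pos.2 (hW.dens_pos x)).ne')

/-- The density is continuous and positive, hence bounded below on compact sets. -/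
lemma exists_restrict_le (hW : IsPot D W) {K : Set (Sp d)} (hK : IsCompact K) :
    ∃ C : ENNReal, C ≠ ⊤ ∧ (vol D d).restrict K ≤ C • gibbs D W := by
  obtain ⟨M, hM⟩ := hK.exists_bound_of_continuousOn
    (f := fun x => (dens D W x)⁻¹)
    (hW.continuous_dens.inv₀ fun x => (hW.dens_pos x).ne').continuousOn
  refine ⟨ENNReal.ofReal M, ENNReal.ofReal_ne_top, ?_⟩
  have hmeas : Measurable fun x => ENNReal.ofReal (dens D W x) :=
    hW.continuous_dens.measurable.ennreal_ofReal
  calc (vol D d).restrict K = ((vol D d).restrict K).withDensity 1 := withDensity_one.symm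
    _ ≤ ((vol D d).restrict K).withDensity
        (ENNReal.ofReal M • fun x => ENNReal.ofReal (dens D W x)) := by
      refine withDensity_mono ?_
      filter_upwards [ae_restrict_mem hK.measurableSet] with x hx
      have h1 := hM x hx
      have h2 := hW.dens_pos x
      rw [Real.norm_of_nonneg (inv_pos.2 h2).le] at h1
      simp only [Pi.one_apply, Pi.smul_apply, smul_eq_mul]
      rw [← ENNReal.ofReal_mul ((inv_pos.2 h2).le.trans h1), ← ENNReal.ofReal_one]
      refine ENNReal.ofReal_le_ofReal ?_
      calc (1 : ℝ) = (dens D W x)⁻¹ * dens D W x := (inv_mul_cancel₀ h2.ne').symm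
        _ ≤ _ := mul_le_mul_of_nonneg_right h1 h2.le
    _ = ENNReal.ofReal M • (gibbs D W).restrict K := by
      rw [withDensity_smul _ hmeas, gibbs, restrict_withDensity hK.measurableSet]
      rfl
    _ ≤ ENNReal.ofReal M • gibbs D W := by
      gcongr
      exact Measure.restrict_le_self

lemma memLp_restrict (hW : IsPot D W) {E : Type} [NormedAddCommGroup E] {h : Sp d → E} {p : ENNReal}
    (hh : MemLp h p (gibbs D W)) {K : Set (Sp d)} (hK : IsCompact K) :
    MemLp h p ((vol D d).restrict K) := by
  obtain ⟨C, hC, hle⟩ := hW.exists_restrict_le hK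
  exact hh.of_measure_le_smul hC hle

lemma locallyIntegrable (hW : IsPot D W) {E : Type} [NormedAddCommGroup E] {h : Sp d → E}
    (hh : MemLp h 2 (gibbs D W)) : LocallyIntegrable h (vol D d) := by
  rw [locallyIntegrable_iff]
  intro K hK
  have : IsFiniteMeasure ((vol D d).restrict K) := ⟨by simpa using hK.measure_lt_top⟩
  exact (hW.memLp_restrict hh hK).integrable (by norm_num)

end IsPot

lemma vol_torus_restrict :
    (vol Dom.torus d).restrict (Metric.closedBall 0 (Real.pi * √d)) = vol Dom.torus d := by
  rw [vol_torus, Measure.restrict_restrict measurableSet_closedBall,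
    Set.inter_eq_right.2 cell_subset_closedBall]

lemma IsPot.l2loc {D : Dom} {W : Sp d → ℝ} (hW : IsPot D W) {E : Type} [NormedAddCommGroup E]
    {h : Sp d → E} (hon : IsOn D h) (hh : MemLp h 2 (gibbs D W)) : L2loc h := by
  cases D with
  | line => exact fun K hK => hW.memLp_restrict hh hK
  | torus =>
    have := hW.memLp_restrict hh (isCompact_closedBall (0 : Sp d) (Real.pi * √d))
    rw [vol_torus_restrict] at this
    exact hon.l2loc this

/-- The bound is only almost everywhere because `q` need not be periodic: on the torus the measure
sees only a compact ball. -/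
lemma exists_ae_bound {D : Dom} {q : Sp d → ℝ} (hq : Continuous q)
    (hc : D = Dom.line → HasCompactSupport q) : ∃ C : ℝ, ∀ᵐ x ∂(vol D d), ‖q x‖ ≤ C := by
  cases D with
  | line =>
    obtain ⟨C, hC⟩ := hq.bounded_above_of_compact_support (hc rfl)
    exact ⟨C, Eventually.of_forall hC⟩
  | torus =>
    obtain ⟨C, hC⟩ := (isCompact_closedBall (0 : Sp d) (Real.pi * √d)).exists_bound_of_continuousOn
      hq.continuousOn
    refine ⟨C, ?_⟩
    rw [← vol_torus_restrict]
    filter_upwards [ae_restrict_mem measurableSet_closedBall] with x hx using hC x hx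

lemma IsPot.memLp_of_continuous {D : Dom} {W : Sp d → ℝ} (hW : IsPot D W) {q : Sp d → ℝ}
    (hq : Continuous q) (hc : D = Dom.line → HasCompactSupport q) (p : ENNReal) :
    MemLp q p (gibbs D W) := by
  have := hW.isProbabilityMeasure
  obtain ⟨C, hC⟩ := exists_ae_bound hq hc
  exact MemLp.of_bound hq.aestronglyMeasurable C (hW.gibbs_ac hC)

/-! ### Weak equations tested against Sobolev functions -/

lemma integrable_inner_of_memLp {μ : Measure (Sp d)} {G H : Sp d → Sp d} (hG : MemLp G 2 μ)
    (hH : MemLp H 2 μ) : Integrable (fun x => inner ℝ (G x) (H x)) μ := by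
  have := hG.norm.integrable_mul hH.norm
  exact this.mono' (hG.1.inner hH.1) (Eventually.of_forall fun x => norm_inner_le_norm _ _)

lemma continuous_gradient {ξ : Sp d → ℝ} (hξ : ContDiff ℝ ∞ ξ) : Continuous (gradient ξ) :=
  (InnerProductSpace.toDual ℝ (Sp d)).symm.continuous.comp (hξ.continuous_fderiv (by simp))

/-- Dilations `b(x/(n+1))` of one bump: each derivative gains the factor `1/(n+1)`, at most 1 and
tending to 0. -/
lemma exists_cutoff (d : ℕ) : ∃ (χ : ℕ → Sp d → ℝ) (M : ℝ), (∀ n, IsTest Dom.line (χ n)) ∧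
    (∀ n x, |χ n x| ≤ 1) ∧ (∀ x, Tendsto (fun n => χ n x) atTop (𝓝 1)) ∧
    (∀ n x v, |inner ℝ v (gradient (χ n) x)| ≤ M * ‖v‖) ∧
    ∀ x v, Tendsto (fun n => inner ℝ v (gradient (χ n) x)) atTop (𝓝 0) := by
  let b : ContDiffBump (0 : Sp d) := ⟨1, 2, one_pos, one_lt_two⟩
  have hb : IsTest Dom.line b := ⟨⟨trivial, b.contDiff⟩, fun _ => b.hasCompactSupport⟩
  obtain ⟨M, hM⟩ := (b.contDiff.continuous_fderiv (n := ∞) (by simp)).bounded_above_of_compact_support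
    (b.hasCompactSupport.fderiv ℝ)
  have hM0 : 0 ≤ M := (norm_nonneg _).trans (hM 0)
  let c : ℕ → ℝ := fun n => 1 / ((n : ℝ) + 1)
  have hc0 : ∀ n, 0 < c n := fun n => by positivity
  have hc1 : ∀ n, c n ≤ 1 := fun n => by
    simp only [c]; rw [div_le_one (by positivity)]
    have : (0 : ℝ) ≤ n := n.cast_nonneg
    linarith
  have hct : Tendsto c atTop (𝓝 0) := tendsto_one_div_add_atTop_nhds_zero_nat
  have hgrad : ∀ n x v, inner ℝ v (gradient (fun x => b (c n • x)) x)
      = c n * fderiv ℝ b (c n • x) v := by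
    intro n x v
    rw [real_inner_comm, inner_gradient_left]
    have h1 : HasFDerivAt (fun x : Sp d => b (c n • x)) ((fderiv ℝ b (c n • x)).comp
        (c n • ContinuousLinearMap.id ℝ (Sp d))) x :=
      ((b.contDiff (n := 1).differentiable (by simp) (c n • x)).hasFDerivAt).comp x
        ((hasFDerivAt_id x).const_smul (c n))
    rw [h1.fderiv]; simp
  have hbd : ∀ n x v, |inner ℝ v (gradient (fun x => b (c n • x)) x)| ≤ c n * (M * ‖v‖) := by
    intro n x v
    rw [hgrad, abs_mul, abs_of_pos (hc0 n)]
    refine mul_le_mul_of_nonneg_left ?_ (hc0 n).le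
    exact (ContinuousLinearMap.le_opNorm _ _).trans
      (mul_le_mul_of_nonneg_right (hM _) (norm_nonneg _))
  refine ⟨fun n x => b (c n • x), M, fun n => ⟨⟨trivial, ?_⟩, fun _ => ?_⟩, fun n x => ?_,
    fun x => ?_, fun n x v => ?_, fun x v => ?_⟩
  · exact b.contDiff.comp (contDiff_id.const_smul (c n))
  · exact b.hasCompactSupport.comp_smul (hc0 n).ne'
  · rw [abs_of_nonneg b.nonneg]; exact b.le_one
  · have h1 : Tendsto (fun n => b (c n • x)) atTop (𝓝 (b ((0 : ℝ) • x))) :=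
      (b.continuous.tendsto _).comp (hct.smul_const x)
    rwa [zero_smul, b.one_of_mem_closedBall (by simp [b])] at h1
  · refine (hbd n x v).trans ?_
    exact mul_le_of_le_one_left (by positivity) (hc1 n)
  · refine squeeze_zero_norm (fun n => hbd n x v) ?_
    simpa using hct.mul_const (M * ‖v‖)

lemma IsOn.comp₂ {D : Dom} {α β γ : Type} {g : Sp d → α} {h : Sp d → β} (hg : IsOn D g)
    (hh : IsOn D h) (m : α → β → γ) : IsOn D fun x => m (g x) (h x) := by
  cases D with
  | line => trivial
  | torus => intro i x; simp only [hg i x, hh i x]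

lemma IsOn.comp {D : Dom} {α γ : Type} {g : Sp d → α} (hg : IsOn D g)
    (m : α → γ) : IsOn D fun x => m (g x) := by
  cases D with
  | line => trivial
  | torus => intro i x; simp only [hg i x]

/-- A weak equation which holds for test functions can be tested against `H¹`. -/
theorem green {D : Dom} {W : Sp d → ℝ} (hW : IsPot D W) {ψ : Sp d → ℝ} {H : Sp d → Sp d}
    (hψ : MemH1 D (gibbs D W) ψ H) {G : Sp d → Sp d} (hGo : IsOn D G)
    (hG : MemLp G 2 (gibbs D W)) {g : Sp d → ℝ} (hgo : IsOn D g) (hg : MemLp g 2 (gibbs D W))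
    (heq : ∀ ξ : Sp d → ℝ, IsTest D ξ →
      ∫ x, inner ℝ (G x) (gradient ξ x) ∂(gibbs D W) = ∫ x, g x * ξ x ∂(gibbs D W)) :
    ∫ x, inner ℝ (G x) (H x) ∂(gibbs D W) = ∫ x, g x * ψ x ∂(gibbs D W) := by
  have hw := hψ.weakGrad.to_line
  have hψL := hW.l2loc hψ.weakGrad.isOn_fun hψ.memLp_fun
  have hHL := hW.l2loc hψ.weakGrad.isOn_grad hψ.memLp_grad
  have hAo : IsOn D fun x => dens D W x • G x := hW.isOn_dens.comp₂ hGo fun r v => r • v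
  have hao : IsOn D fun x => dens D W x * g x := hW.isOn_dens.comp₂ hgo fun r v => r * v
  have hAL : L2loc fun x => dens D W x • G x := (hW.l2loc hGo hG).continuous_smul hW.continuous_dens
  have haL : L2loc fun x => dens D W x * g x := (hW.l2loc hgo hg).continuous_smul hW.continuous_dens
  set A := fun x => dens D W x • G x with hA
  set a := fun x => dens D W x * g x with ha
  have hip : Integrable (fun x => inner ℝ (A x) (H x)) (vol D d) := by
    have := hW.integrable_gibbs_iff.1 (integrable_inner_of_memLp hG hψ.memLp_grad)
    simpa only [hA, real_inner_smul_left, smul_eq_mul] using this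
  have hiq : Integrable (fun x => ‖ψ x‖ * ‖A x‖) (vol D d) := by
    have := hW.integrable_gibbs_iff.1 (hψ.memLp_fun.norm.integrable_mul hG.norm)
    refine this.congr (Eventually.of_forall fun x => ?_)
    simp only [hA, norm_smul, Real.norm_of_nonneg (hW.dens_pos x).le, smul_eq_mul, Pi.mul_apply]
    ring
  have hir : Integrable (fun x => a x * ψ x) (vol D d) := by
    have := hW.integrable_gibbs_iff.1 (hg.integrable_mul hψ.memLp_fun)
    refine this.congr (Eventually.of_forall fun x => ?_)
    simp only [ha, Pi.mul_apply, smul_eq_mul]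
    ring
  have heq' : ∀ ξ : Sp d → ℝ, IsTest D ξ →
      ∫ x, inner ℝ (A x) (gradient ξ x) ∂(vol D d) = ∫ x, a x * ξ x ∂(vol D d) := by
    intro ξ hξ
    have := heq ξ hξ
    rw [hW.integral_gibbs, hW.integral_gibbs] at this
    simpa only [hA, ha, real_inner_smul_left, smul_eq_mul, mul_assoc] using this
  rw [hW.integral_gibbs, hW.integral_gibbs]
  suffices hs : ∫ x, inner ℝ (A x) (H x) ∂(vol D d) = ∫ x, a x * ψ x ∂(vol D d) by
    simpa only [hA, ha, real_inner_smul_left, smul_eq_mul, mul_assoc] using hs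
  clear_value A a
  cases D with
  | line =>
    -- The cutoff error `ψ A · ∇χ_n` is dominated by the integrable `M |ψ| |A|` and tends to zero
    -- pointwise, so no decay of `ψ` beyond `L²` is needed.
    obtain ⟨χ, M, hχ, hχ1, hχt, hM, hMt⟩ := exists_cutoff d
    have hloc := fun n => local_green hw hψL hHL hAL haL heq' (hχ n)
    have hAm : AEStronglyMeasurable A (vol Dom.line d) := hAL.locallyIntegrable.aestronglyMeasurable
    have hψm := hψ.weakGrad.locInt_fun.aestronglyMeasurable
    have l1 : Tendsto (fun n => ∫ x, χ n x * inner ℝ (A x) (H x) +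
        ψ x * inner ℝ (A x) (gradient (χ n) x)) atTop (𝓝 (∫ x, inner ℝ (A x) (H x))) := by
      refine tendsto_integral_of_dominated_convergence
        (fun x => ‖inner ℝ (A x) (H x)‖ + M * (‖ψ x‖ * ‖A x‖)) (fun n => ?_)
        (hip.norm.add (hiq.const_mul M)) (fun n => Eventually.of_forall fun x => ?_)
        (Eventually.of_forall fun x => ?_)
      · refine ((hχ n).continuous.aestronglyMeasurable.mul hip.1).add (hψm.mul ?_)
        exact hAm.inner (continuous_gradient (hχ n).smooth.contDiff).aestronglyMeasurable
      · refine (norm_add_le _ _).trans (add_le_add ?_ ?_)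
        · rw [norm_mul]
          exact mul_le_of_le_one_left (norm_nonneg _) (hχ1 n x)
        · rw [norm_mul]
          calc ‖ψ x‖ * ‖inner ℝ (A x) (gradient (χ n) x)‖ ≤ ‖ψ x‖ * (M * ‖A x‖) :=
                mul_le_mul_of_nonneg_left (hM n x _) (norm_nonneg _)
            _ = _ := by ring
      · simpa using ((hχt x).mul_const (inner ℝ (A x) (H x))).add ((hMt x (A x)).const_mul (ψ x))
    have l2 : Tendsto (fun n => ∫ x, χ n x * (a x * ψ x)) atTop (𝓝 (∫ x, a x * ψ x)) := by
      refine tendsto_integral_of_dominated_convergence (fun x => ‖a x * ψ x‖) (fun n => ?_)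
        hir.norm (fun n => Eventually.of_forall fun x => ?_)
        (Eventually.of_forall fun x => ?_)
      · exact (hχ n).continuous.aestronglyMeasurable.mul hir.1
      · rw [norm_mul]
        exact mul_le_of_le_one_left (norm_nonneg _) (hχ1 n x)
      · simpa using (hχt x).mul_const (a x * ψ x)
    exact tendsto_nhds_unique (l1.congr hloc) l2
  | torus =>
    have hAi : ∀ i, Integrable (fun x => A x i) (vol Dom.torus d) := fun i =>
      (integrable_torus (hAL.locallyIntegrable.mono_measure (by
        rw [vol_torus]; exact Measure.restrict_le_self))).eval_piLp i
    have hai : Integrable a (vol Dom.torus d) :=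
      integrable_torus (haL.locallyIntegrable.mono_measure (by
        rw [vol_torus]; exact Measure.restrict_le_self))
    have hAio : ∀ i, IsOn Dom.torus fun x => A x i := fun i => hAo.comp fun v => v i
    -- Periodizing the test function turns the torus equation into an equation on `ℝ^d`, to which
    -- `local_green` applies.
    have hl : ∀ ξ : Sp d → ℝ, IsTest Dom.line ξ →
      ∫ x, inner ℝ (A x) (gradient ξ x) = ∫ x, a x * ξ x := by
      intro ξ hξ
      have h := heq' _ hξ.perSum
      rw [integral_mul_perSum hao hai hξ.continuous (hξ.compact rfl)] at h
      rw [← h]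
      simp_rw [sp_inner_eq_sum, gradient_apply, fderiv_perSum hξ]
      have hp := fun i : Fin d => hξ.partial (EuclideanSpace.single i 1)
      have hu := fun i => integral_mul_perSum (hAio i) (hAi i) (hp i).continuous
        ((hp i).compact rfl)
      rw [integral_finsetSum, integral_finsetSum]
      · exact Finset.sum_congr rfl fun i _ => (hu i).symm
      · intro i _
        obtain ⟨C, hC⟩ := exists_ae_bound (D := Dom.torus) (q := perSum fun y => fderiv ℝ ξ y
          (EuclideanSpace.single i 1)) (hp i).perSum.continuous (fun h => by cases h)
        exact (hAi i).mul_bdd (hp i).perSum.continuous.aestronglyMeasurable hC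
      · intro i _
        exact (((hAio i).locallyIntegrable_of_integrable (hAi i))
          ).integrable_smul_right_of_hasCompactSupport (hp i).continuous ((hp i).compact rfl)
    obtain ⟨χ, hχ, h1⟩ := exists_perSum_eq_one d
    have hp := fun i : Fin d => hχ.partial (EuclideanSpace.single i 1)
    have hloc := local_green hw hψL hHL hAL haL hl hχ
    have hψo := hψ.weakGrad.isOn_fun
    have e1 := integral_mul_perSum (hAo.comp₂ hψ.weakGrad.isOn_grad fun v w => inner ℝ v w) hip
      hχ.continuous (hχ.compact rfl)
    have e2 := integral_mul_perSum (hao.comp₂ hψo fun v w => v * w) hir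
      hχ.continuous (hχ.compact rfl)
    have hqi : ∀ i, Integrable (fun x => ψ x * A x i) (vol Dom.torus d) := by
      intro i
      refine hiq.mono' (hψ.weakGrad.locInt_fun.aestronglyMeasurable.mul (hAi i).1)
        (Eventually.of_forall fun x => ?_)
      rw [norm_mul]
      exact mul_le_mul_of_nonneg_left (PiLp.norm_apply_le _ _) (norm_nonneg _)
    have hqo : ∀ i, IsOn Dom.torus fun x => ψ x * A x i := fun i => hψo.comp₂ (hAio i) fun v w => v * w
    have e3 := fun i => integral_mul_perSum (hqo i) (hqi i) (hp i).continuous ((hp i).compact rfl)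
    have i3 := fun i => ((hqo i).locallyIntegrable_of_integrable
      (hqi i)).integrable_smul_right_of_hasCompactSupport (hp i).continuous ((hp i).compact rfl)
    simp only [h1, mul_one, perSum_partial_eq_zero hχ h1, mul_zero, integral_zero] at e1 e2 e3
    rw [e1, e2]
    -- No limit is needed here: the cross term unfolds from the lattice sum of the derivatives of
    -- `χ`, which is zero.
    have e4 : ∫ x, ψ x * inner ℝ (A x) (gradient χ x) = 0 := by
      simp_rw [sp_inner_eq_sum, gradient_apply, Finset.mul_sum, ← mul_assoc]
      rw [integral_finsetSum]
      · exact Finset.sum_eq_zero fun i _ => (e3 i).symm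
      · intro i _; exact i3 i
    have i4 : Integrable (fun x => ψ x * inner ℝ (A x) (gradient χ x)) volume := by
      simp_rw [sp_inner_eq_sum, gradient_apply, Finset.mul_sum, ← mul_assoc]
      exact integrable_finsetSum _ fun i _ => i3 i
    have i1 : Integrable (fun x => χ x * inner ℝ (A x) (H x)) volume :=
      (IsOn.locallyIntegrable_of_integrable (hAo.comp₂ hψ.weakGrad.isOn_grad fun v w =>
        inner ℝ v w) hip).integrable_smul_left_of_hasCompactSupport hχ.continuous (hχ.compact rfl)
    rw [integral_add i1 i4, e4, add_zero] at hloc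
    simp_rw [mul_comm (χ _)] at hloc
    exact hloc

/-! ### Test functions belong to `H¹` -/

lemma IsTest.memLp_partial {D : Dom} {W : Sp d → ℝ} (hW : IsPot D W) {ξ : Sp d → ℝ}
    (hξ : IsTest D ξ) (v : Sp d) : MemLp (fun x => fderiv ℝ ξ x v) 2 (gibbs D W) :=
  hW.memLp_of_continuous
    ((hξ.smooth.contDiff.continuous_fderiv (by simp)).clm_apply continuous_const)
    (fun h => (hξ.compact h).fderiv_apply ℝ v) 2

lemma IsTest.memLp {D : Dom} {W : Sp d → ℝ} (hW : IsPot D W) {ξ : Sp d → ℝ}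
    (hξ : IsTest D ξ) : MemLp ξ 2 (gibbs D W) :=
  hW.memLp_of_continuous hξ.continuous hξ.compact 2

lemma IsTest.memLp_gradient {D : Dom} {W : Sp d → ℝ} (hW : IsPot D W) {ξ : Sp d → ℝ}
    (hξ : IsTest D ξ) : MemLp (gradient ξ) 2 (gibbs D W) :=
  MemLp.of_eval_piLp fun i => by
    simp only [gradient_apply]
    exact hξ.memLp_partial hW _

lemma integrable_vol_of_continuous {D : Dom} {q : Sp d → ℝ} (hq : Continuous q)
    (hc : D = Dom.line → HasCompactSupport q) : Integrable q (vol D d) := by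
  cases D with
  | line => exact hq.integrable_of_hasCompactSupport (hc rfl)
  | torus => exact integrable_torus_of_continuous hq

lemma IsTest.integral_fderiv {D : Dom} {ζ : Sp d → ℝ} (h : IsTest D ζ) (v : Sp d) :
    ∫ x, fderiv ℝ ζ x v ∂(vol D d) = 0 := by
  cases D with
  | torus => exact integral_fderiv_torus h v
  | line =>
    have hd := h.partial v
    have := integral_mul_fderiv_eq_neg_fderiv_mul_of_integrable (μ := (volume : Measure (Sp d)))
      (f := fun _ => (1 : ℝ)) (g := ζ) (v := v) (by simp)
      (by simpa using hd.continuous.integrable_of_hasCompactSupport (hd.compact rfl))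
      (by simpa using h.continuous.integrable_of_hasCompactSupport (h.compact rfl))
      (fun x _ => differentiableAt_const _)
      (fun x _ => h.smooth.contDiff.differentiable (by simp) x)
    simpa [vol] using this

/-- Integration by parts holds because `(ξ - c) η` is a test function and its derivatives integrate
to zero. The constant serves to reach mean zero. -/
lemma IsTest.memH1_sub_const {D : Dom} {W : Sp d → ℝ} (hW : IsPot D W) {ξ : Sp d → ℝ}
    (hξ : IsTest D ξ) (c : ℝ) : MemH1 D (gibbs D W) (fun x => ξ x - c) (gradient ξ) := by
  have := hW.isProbabilityMeasure
  have h1 : MemLp (fun x => ξ x - c) 2 (gibbs D W) := (hξ.memLp hW).sub (memLp_const c)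
  have h2 := hξ.memLp_gradient hW
  have hs := hξ.smooth.contDiff
  refine ⟨⟨hξ.smooth.isOn.comp fun r => r - c, hξ.smooth.isOn.gradient, hW.locallyIntegrable h1,
    hW.locallyIntegrable h2, fun η hη i => ?_⟩, h1, h2⟩
  set v : Sp d := EuclideanSpace.single i 1
  have hse := hη.smooth.contDiff
  have hsc : ContDiff ℝ ∞ fun x => ξ x - c := hs.sub contDiff_const
  have hp : IsTest D fun x => (ξ x - c) * η x :=
    ⟨⟨hξ.smooth.isOn.comp₂ hη.smooth.isOn fun a b => (a - c) * b, hsc.mul hse⟩,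
      fun h => (hη.compact h).mul_left⟩
  have h0 := hp.integral_fderiv v
  simp_rw [fderiv_mul_apply' hse hsc, fderiv_sub_const] at h0
  simp only [gradient_apply]
  rw [integral_add] at h0
  · linarith
  · exact integrable_vol_of_continuous
      (hsc.continuous.mul ((hse.continuous_fderiv (by simp)).clm_apply continuous_const))
      fun h => ((hη.compact h).fderiv_apply ℝ v).mul_left
  · exact integrable_vol_of_continuous
      (((hs.continuous_fderiv (by simp)).clm_apply continuous_const).mul hse.continuous)
      fun h => (hη.compact h).mul_left

/-! ### Representatives defined on the domain -/

/-- The reduction of a point to the fundamental cell, for the torus. -/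
def wrap (D : Dom) (x : Sp d) : Sp d :=
  match D with
  | .line => x
  | .torus => (existsUnique_add_mem_cell 0 x).choose + x

/-- `MemH1` asks for exact periodicity, whereas a representative of an `Lp` class is only determined
almost everywhere on the cell. Composing with `wrap` repairs this without changing the class. -/
lemma isOn_comp_wrap {α : Type} (D : Dom) (h : Sp d → α) : IsOn D fun x => h (wrap D x) := by
  cases D with
  | line => trivial
  | torus =>
    refine isOn_torus_of_add_left fun l hl x => ?_
    have h1 := (existsUnique_add_mem_cell 0 (l + x)).choose_spec.1
    have h2 := (existsUnique_add_mem_cell 0 x).choose_spec.2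
      ((existsUnique_add_mem_cell 0 (l + x)).choose + ⟨l, hl⟩)
      (by simpa [add_assoc] using h1)
    simp only [wrap]
    rw [← h2]
    simp [add_assoc]

lemma comp_wrap_ae {α : Type} (D : Dom) (h : Sp d → α) :
    (fun x => h (wrap D x)) =ᵐ[vol D d] h := by
  cases D with
  | line => exact EventuallyEq.rfl
  | torus =>
    rw [vol_torus]
    filter_upwards [ae_restrict_mem (measurableSet_cell 0)] with x hx
    have h2 := (existsUnique_add_mem_cell 0 x).choose_spec.2 0 (by simpa using hx)
    simp only [wrap]
    rw [← h2]
    simp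

/-! ### The Poisson equation -/

/-- Lax–Milgram for the form `⟨T u, T w⟩`, whose coercivity is `hT`. -/
lemma exists_inner_map_eq {X Y : Type*} [NormedAddCommGroup X] [InnerProductSpace ℝ X]
    [CompleteSpace X] [NormedAddCommGroup Y] [InnerProductSpace ℝ Y] (T : X →L[ℝ] Y) {c : ℝ}
    (hc : 0 < c) (hT : ∀ v, c * ‖v‖ ^ 2 ≤ ‖T v‖ ^ 2) (q : X) :
    ∃ u, ∀ w, inner ℝ (T u) (T w) = inner ℝ q w := by
  let B : X →L[ℝ] X →L[ℝ] ℝ := (innerSL ℝ).bilinearComp T T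
  have hB : ∀ u w, B u w = inner ℝ (T u) (T w) := fun u w => rfl
  have hco : IsCoercive B := by
    refine ⟨c, hc, fun u => ?_⟩
    rw [hB, real_inner_self_eq_norm_sq, mul_assoc, ← sq]
    exact hT u
  refine ⟨hco.continuousLinearEquivOfBilin.symm q, fun w => ?_⟩
  rw [← hB, ← hco.continuousLinearEquivOfBilin_apply, ContinuousLinearEquiv.apply_symm_apply]

section Sobolev

variable {D : Dom} {W : Sp d → ℝ}

/-- The ambient Hilbert space for pairs of a function and its weak gradient. -/
abbrev PairSp (D : Dom) (W : Sp d → ℝ) : Type :=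
  WithLp 2 (Lp ℝ 2 (gibbs D W) × Lp (Sp d) 2 (gibbs D W))

lemma MemH1.congr_wrap (hW : IsPot D W) {φ : Sp d → ℝ} {G : Sp d → Sp d}
    (hφ : MemLp φ 2 (gibbs D W)) (hG : MemLp G 2 (gibbs D W))
    (hp : ∀ ξ : Sp d → ℝ, IsTest D ξ → ∀ i : Fin d,
      ∫ x, φ x * (gradient ξ x) i ∂(vol D d) = -∫ x, G x i * ξ x ∂(vol D d)) :
    MemH1 D (gibbs D W) (fun x => φ (wrap D x)) (fun x => G (wrap D x)) := by
  have e1 := comp_wrap_ae D φ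
  have e2 := comp_wrap_ae D G
  have h1 := hφ.ae_eq (hW.gibbs_ac.ae_eq e1).symm
  have h2 := hG.ae_eq (hW.gibbs_ac.ae_eq e2).symm
  refine ⟨⟨isOn_comp_wrap D φ, isOn_comp_wrap D G, hW.locallyIntegrable h1,
    hW.locallyIntegrable h2, fun ξ hξ i => ?_⟩, h1, h2⟩
  have i1 := integral_congr_ae (f := fun x => φ (wrap D x) * (gradient ξ x) i)
    (g := fun x => φ x * (gradient ξ x) i) (μ := vol D d) (by
      filter_upwards [e1] with x hx; rw [hx])
  have i2 := integral_congr_ae (f := fun x => G (wrap D x) i * ξ x)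
    (g := fun x => G x i * ξ x) (μ := vol D d) (by
      filter_upwards [e2] with x hx; rw [hx])
  rw [i1, i2, hp ξ hξ i]

/-- The inverse density turns Lebesgue pairings into inner products in `L²(μ)`. Integration by parts
against a fixed test function thus becomes orthogonality to a vector of `PairSp`. -/
lemma IsPot.memLp_div_dens (hW : IsPot D W) {q : Sp d → ℝ} (hq : Continuous q)
    (hc : D = Dom.line → HasCompactSupport q) :
    MemLp (fun x => (dens D W x)⁻¹ * q x) 2 (gibbs D W) :=
  hW.memLp_of_continuous ((hW.continuous_dens.inv₀ fun x => (hW.dens_pos x).ne').mul hq)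
    (fun h => (hc h).mul_left) 2

lemma IsPot.integral_vol (hW : IsPot D W) (h : Sp d → ℝ) :
    ∫ x, h x ∂(vol D d) = ∫ x, (dens D W x)⁻¹ * h x ∂(gibbs D W) := by
  rw [hW.integral_gibbs]
  refine integral_congr_ae (Eventually.of_forall fun x => ?_)
  exact (smul_inv_smul₀ (hW.dens_pos x).ne' (h x)).symm

/-- The constraint expressing integration by parts against `ξ` in the direction `i`. -/
def partsVec (hW : IsPot D W) {ξ : Sp d → ℝ} (hξ : IsTest D ξ) (i : Fin d) : PairSp D W :=
  WithLp.toLp 2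
    ((hW.memLp_div_dens (q := fun x => fderiv ℝ ξ x (EuclideanSpace.single i 1))
        ((hξ.smooth.contDiff.continuous_fderiv (by simp)).clm_apply continuous_const)
        (fun h => (hξ.compact h).fderiv_apply ℝ _)).toLp _,
      ((hW.memLp_div_dens hξ.continuous hξ.compact).continuousLinearMap_comp
        ((ContinuousLinearMap.id ℝ ℝ).smulRight (EuclideanSpace.single i (1 : ℝ) : Sp d))).toLp _)

lemma inner_partsVec (hW : IsPot D W) {ξ : Sp d → ℝ} (hξ : IsTest D ξ) (i : Fin d)
    (p : PairSp D W) : inner ℝ (partsVec hW hξ i) p =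
      (∫ x, p.fst x * (gradient ξ x) i ∂(vol D d)) + ∫ x, p.snd x i * ξ x ∂(vol D d) := by
  rw [WithLp.prod_inner_apply, L2.inner_def, L2.inner_def]
  congr 1
  · rw [hW.integral_vol]
    refine integral_congr_ae ?_
    filter_upwards [MemLp.coeFn_toLp (hW.memLp_div_dens
      (q := fun x => fderiv ℝ ξ x (EuclideanSpace.single i 1))
      ((hξ.smooth.contDiff.continuous_fderiv (by simp)).clm_apply continuous_const)
      (fun h => (hξ.compact h).fderiv_apply ℝ _))] with x hx
    simp only [partsVec, gradient_apply]
    rw [hx]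
    simp only [RCLike.inner_apply, conj_trivial, WithLp.fst]
    ring
  · rw [hW.integral_vol]
    refine integral_congr_ae ?_
    filter_upwards [MemLp.coeFn_toLp ((hW.memLp_div_dens hξ.continuous
      hξ.compact).continuousLinearMap_comp
      ((ContinuousLinearMap.id ℝ ℝ).smulRight (EuclideanSpace.single i (1 : ℝ) : Sp d)))] with x hx
    simp only [partsVec]
    rw [hx]
    simp only [ContinuousLinearMap.smulRight_apply, ContinuousLinearMap.id_apply,
      real_inner_smul_left, EuclideanSpace.inner_single_left, WithLp.snd]
    simp
    ring

/-- The constraint of mean zero. -/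
def meanVec (hW : IsPot D W) : PairSp D W :=
  have := hW.isProbabilityMeasure
  WithLp.toLp 2 ((memLp_const (μ := gibbs D W) (p := 2) (1 : ℝ)).toLp _, 0)

lemma inner_meanVec (hW : IsPot D W) (p : PairSp D W) :
    inner ℝ (meanVec hW) p = ∫ x, p.fst x ∂(gibbs D W) := by
  have := hW.isProbabilityMeasure
  rw [WithLp.prod_inner_apply, L2.inner_def]
  simp only [meanVec, inner_zero_left, add_zero]
  refine integral_congr_ae ?_
  filter_upwards [MemLp.coeFn_toLp (memLp_const (μ := gibbs D W) (p := 2) (1 : ℝ))] with x hx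
  rw [hx]
  change inner ℝ (1 : ℝ) (p.fst x) = p.fst x
  simp

/-- The Hilbert space `H¹ ∩ L²₀`. -/
def sobolev (hW : IsPot D W) : Submodule ℝ (PairSp D W) :=
  (Submodule.span ℝ (insert (meanVec hW)
    {s | ∃ (ξ : Sp d → ℝ) (hξ : IsTest D ξ) (i : Fin d), s = partsVec hW hξ i}))ᗮ

lemma mem_sobolev (hW : IsPot D W) {p : PairSp D W} : p ∈ sobolev hW ↔
    ∫ x, p.fst x ∂(gibbs D W) = 0 ∧ ∀ ξ : Sp d → ℝ, IsTest D ξ → ∀ i : Fin d,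
      ∫ x, p.fst x * (gradient ξ x) i ∂(vol D d) = -∫ x, p.snd x i * ξ x ∂(vol D d) := by
  have h0 : p ∈ sobolev hW ↔ ∀ s ∈ insert (meanVec hW)
      {s | ∃ (ξ : Sp d → ℝ) (hξ : IsTest D ξ) (i : Fin d), s = partsVec hW hξ i},
      inner ℝ s p = 0 := by
    rw [sobolev, Submodule.mem_orthogonal]
    refine ⟨fun h s hs => h s (Submodule.subset_span hs), fun h u hu => ?_⟩
    induction hu using Submodule.span_induction with
    | mem x hx => exact h x hx
    | zero => simp
    | add x y _ _ hx hy => rw [inner_add_left, hx, hy, add_zero]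
    | smul a x _ hx => rw [real_inner_smul_left, hx, mul_zero]
  rw [h0]
  constructor
  · intro h
    refine ⟨by rw [← inner_meanVec hW]; exact h _ (Set.mem_insert _ _), fun ξ hξ i => ?_⟩
    have := h _ (Set.mem_insert_of_mem _ ⟨ξ, hξ, i, rfl⟩)
    rw [inner_partsVec] at this
    linarith
  · rintro ⟨h1, h2⟩ s (rfl | ⟨ξ, hξ, i, rfl⟩)
    · rwa [inner_meanVec]
    · rw [inner_partsVec, h2 ξ hξ i]
      ring

lemma norm_sq_toLp {E : Type} [NormedAddCommGroup E] [InnerProductSpace ℝ E]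
    {μ : Measure (Sp d)} (p : Lp E 2 μ) : ‖p‖ ^ 2 = ∫ x, ‖p x‖ ^ 2 ∂μ := by
  rw [← real_inner_self_eq_norm_sq, L2.inner_def]
  simp only [real_inner_self_eq_norm_sq]

/-- Weak solutions to the Poisson equation on `H¹ ∩ L²₀`. -/
theorem exists_weak_solution (hW : IsPot D W) (hP : Poincare D (gibbs D W)) {g : Sp d → ℝ}
    (hg : MemLp g 2 (gibbs D W)) : ∃ φ G, MemH1 D (gibbs D W) φ G ∧
      ∫ x, φ x ∂(gibbs D W) = 0 ∧ ∀ ψ H, MemH1 D (gibbs D W) ψ H → ∫ x, ψ x ∂(gibbs D W) = 0 →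
        ∫ x, inner ℝ (G x) (H x) ∂(gibbs D W) = ∫ x, g x * ψ x ∂(gibbs D W) := by
  obtain ⟨R, hR, hP⟩ := hP
  -- An orthogonal complement is closed, so completeness of the Sobolev space comes from its
  -- definition.
  have hcomplete : CompleteSpace (sobolev hW) := by
    unfold sobolev; infer_instance
  let T : sobolev hW →L[ℝ] Lp (Sp d) 2 (gibbs D W) :=
    (WithLp.sndL 2 ℝ _ _).comp (sobolev hW).subtypeL
  have hTa : ∀ p, T p = p.1.snd := fun p => rfl
  have hmem : ∀ p : sobolev hW, MemH1 D (gibbs D W) (fun x => p.1.fst (wrap D x))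
      (fun x => p.1.snd (wrap D x)) ∧ ∫ x, p.1.fst (wrap D x) ∂(gibbs D W) = 0 := by
    intro p
    obtain ⟨h1, h2⟩ := (mem_sobolev hW).1 p.2
    refine ⟨MemH1.congr_wrap hW (Lp.memLp _) (Lp.memLp _) h2, ?_⟩
    rw [← h1]
    exact integral_congr_ae (hW.gibbs_ac (comp_wrap_ae D _))
  -- By Poincaré, `‖φ‖² + ‖G‖² ≤ (1/R + 1) ‖G‖²`: the gradient alone controls the full norm.
  have hT : ∀ p : sobolev hW, (1 / R + 1)⁻¹ * ‖p‖ ^ 2 ≤ ‖T p‖ ^ 2 := by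
    intro p
    obtain ⟨h1, h2⟩ := hmem p
    have h3 := hP _ _ h1 h2
    have i1 : ∫ x, p.1.fst (wrap D x) ^ 2 ∂(gibbs D W) = ‖p.1.fst‖ ^ 2 := by
      rw [norm_sq_toLp]
      refine integral_congr_ae ?_
      filter_upwards [hW.gibbs_ac (comp_wrap_ae D (p.1.fst : Sp d → ℝ))] with x hx
      rw [hx]; simp
    have i2 : ∫ x, ‖p.1.snd (wrap D x)‖ ^ 2 ∂(gibbs D W) = ‖p.1.snd‖ ^ 2 := by
      rw [norm_sq_toLp]
      refine integral_congr_ae ?_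
      filter_upwards [hW.gibbs_ac (comp_wrap_ae D (p.1.snd : Sp d → Sp d))] with x hx
      rw [hx]
    rw [i1, i2] at h3
    have h4 : ‖p‖ ^ 2 = ‖p.1.fst‖ ^ 2 + ‖p.1.snd‖ ^ 2 := WithLp.prod_norm_sq_eq_of_L2 p.1
    have hR' : 0 < 1 / R + 1 := by positivity
    rw [hTa, inv_mul_le_iff₀ hR', h4]
    linarith
  let q : PairSp D W := WithLp.toLp 2 (hg.toLp g, 0)
  have hK : (sobolev hW).HasOrthogonalProjection := inferInstance
  -- The vector `(g, 0)` need not lie in the Sobolev space; its projection has the same inner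
  -- products with that space.
  obtain ⟨u, hu⟩ := exists_inner_map_eq T (by positivity) hT
    ((sobolev hW).orthogonalProjectionOnto q)
  refine ⟨_, _, (hmem u).1, (hmem u).2, fun ψ H hψ h0 => ?_⟩
  let w : PairSp D W := WithLp.toLp 2 (hψ.memLp_fun.toLp ψ, hψ.memLp_grad.toLp H)
  have e1 : w.fst =ᵐ[gibbs D W] ψ := hψ.memLp_fun.coeFn_toLp
  have e2 : w.snd =ᵐ[gibbs D W] H := hψ.memLp_grad.coeFn_toLp
  have hw : w ∈ sobolev hW := by
    rw [mem_sobolev]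
    refine ⟨by rw [integral_congr_ae e1, h0], fun ξ hξ i => ?_⟩
    rw [integral_congr_ae (g := fun x => ψ x * (gradient ξ x) i)
        (by filter_upwards [hW.vol_ac e1] with x hx; rw [hx]),
      integral_congr_ae (f := fun x => w.snd x i * ξ x) (g := fun x => H x i * ξ x)
        (by filter_upwards [hW.vol_ac e2] with x hx; rw [hx])]
    exact hψ.weakGrad.parts ξ hξ i
  have key := hu ⟨w, hw⟩
  rw [Submodule.inner_orthogonalProjectionOnto_eq_of_mem_right, WithLp.prod_inner_apply,
    L2.inner_def, L2.inner_def] at key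
  simp only [q, inner_zero_left, add_zero] at key
  have k1 : ∫ x, inner ℝ (u.1.snd (wrap D x)) (H x) ∂(gibbs D W) =
      ∫ x, inner ℝ ((T u : Sp d → Sp d) x) ((T ⟨w, hw⟩ : Sp d → Sp d) x) ∂(gibbs D W) := by
    refine integral_congr_ae ?_
    filter_upwards [hW.gibbs_ac (comp_wrap_ae D (u.1.snd : Sp d → Sp d)), e2] with x h1 h2
    rw [hTa, hTa, h1, h2]
  rw [k1, key]
  refine integral_congr_ae ?_
  filter_upwards [hg.coeFn_toLp, hψ.memLp_fun.coeFn_toLp] with x h1 h2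
  rw [h1]
  change inner ℝ (g x) ((hψ.memLp_fun.toLp ψ : Sp d → ℝ) x) = _
  rw [h2]
  simp [mul_comm]

end Sobolev

/-! ### Well-posedness and stability under bounded perturbations -/

/-- The analytic part of the admissibility of a biasing potential. -/
structure Regular (D : Dom) (V f U : Sp d → ℝ) : Prop where
  smooth : IsSmooth D U
  pot : IsPot D (V + U)
  poincare : Poincare D (gibbs D (V + U))
  memLp : MemLp (fun x => (f x - mean D V f) * Real.exp (U x)) 2 (gibbs D (V + U))

lemma IsSmooth.add {D : Dom} {g h : Sp d → ℝ} (hg : IsSmooth D g) (hh : IsSmooth D h) :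
    IsSmooth D (g + h) :=
  ⟨hg.isOn.comp₂ hh.isOn fun a b => a + b, hg.contDiff.add hh.contDiff⟩

lemma IsSmooth.const_smul {D : Dom} {g : Sp d → ℝ} (hg : IsSmooth D g) (c : ℝ) :
    IsSmooth D (c • g) :=
  ⟨hg.isOn.comp fun a => c • a, hg.contDiff.const_smul c⟩

variable {D : Dom} {V f U : Sp d → ℝ}

lemma Standing.isPot (h : Standing D V f) : IsPot D V := ⟨h.smooth_pot, h.integrable_exp⟩

lemma Admissible.regular (hVf : Standing D V f) (h : Admissible D V f U) : Regular D V f U :=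
  ⟨h.smooth, ⟨hVf.smooth_pot.add h.smooth, h.integrable_exp⟩, h.poincare, h.memLp⟩

lemma Zc_mul_integral {W : Sp d → ℝ} (hW : IsPot D W) (h : Sp d → ℝ) :
    Zc D W * ∫ x, h x ∂(gibbs D W) = ∫ x, Real.exp (-W x) * h x ∂(vol D d) := by
  rw [hW.integral_gibbs, ← integral_const_mul]
  refine integral_congr_ae (Eventually.of_forall fun x => ?_)
  have := hW.Zc_pos.ne'
  simp only [dens, smul_eq_mul]
  field_simp

/-- The cancellation `e^{-V-U} e^U = e^{-V}` behind the whole computation: the right side is free of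
`U`. -/
lemma Zc_mul_integral_source (hU : Regular D V f U) (ψ : Sp d → ℝ) :
    Zc D (V + U) * ∫ x, (f x - mean D V f) * Real.exp (U x) * ψ x ∂(gibbs D (V + U)) =
      ∫ x, Real.exp (-V x) * ((f x - mean D V f) * ψ x) ∂(vol D d) := by
  rw [Zc_mul_integral hU.pot]
  refine integral_congr_ae (Eventually.of_forall fun x => ?_)
  have h : Real.exp (-(V + U) x) * Real.exp (U x) = Real.exp (-V x) := by
    rw [← Real.exp_add]; simp
  simp only
  rw [← h]
  ring

/-- The solvability condition of the Poisson equation, from testing with `ψ = 1`. -/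
lemma integral_source (hVf : Standing D V f) (hU : Regular D V f U) :
    ∫ x, (f x - mean D V f) * Real.exp (U x) ∂(gibbs D (V + U)) = 0 := by
  have h1 := Zc_mul_integral_source hU (fun _ => 1)
  have := hVf.isPot.isProbabilityMeasure
  have h2 : ∫ x, (f x - mean D V f) * 1 ∂(gibbs D V) = 0 := by
    simp only [mul_one]
    rw [integral_sub hVf.integrable_obs (integrable_const _)]
    simp [mean]
  rw [← Zc_mul_integral hVf.isPot, h2, mul_zero] at h1
  simpa [hU.pot.Zc_pos.ne'] using h1

lemma Regular.isOn_source (hVf : Standing D V f) (hU : Regular D V f U) :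
    IsOn D fun x => (f x - mean D V f) * Real.exp (U x) :=
  hVf.smooth_obs.isOn.comp₂ hU.smooth.isOn fun a b => (a - mean D V f) * Real.exp b

lemma IsPoissonSol.weak_eq (hVf : Standing D V f) (hU : Regular D V f U) {φ : Sp d → ℝ}
    {G : Sp d → Sp d} (h : IsPoissonSol D V f U φ G) {ψ : Sp d → ℝ} {H : Sp d → Sp d}
    (hψ : MemH1 D (gibbs D (V + U)) ψ H) :
    ∫ x, inner ℝ (G x) (H x) ∂(gibbs D (V + U)) =
      ∫ x, (f x - mean D V f) * Real.exp (U x) * ψ x ∂(gibbs D (V + U)) :=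
  green hU.pot hψ h.memH1.weakGrad.isOn_grad h.memH1.memLp_grad (hU.isOn_source hVf) hU.memLp h.eq

lemma MemH1.sub {m : Measure (Sp d)} {φ ψ : Sp d → ℝ} {G H : Sp d → Sp d}
    (h : MemH1 D m φ G) (h' : MemH1 D m ψ H) :
    MemH1 D m (fun x => φ x - ψ x) (fun x => G x - H x) := by
  refine ⟨⟨h.weakGrad.isOn_fun.comp₂ h'.weakGrad.isOn_fun fun a b => a - b,
    h.weakGrad.isOn_grad.comp₂ h'.weakGrad.isOn_grad fun a b => a - b,
    h.weakGrad.locInt_fun.sub h'.weakGrad.locInt_fun,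
    h.weakGrad.locInt_grad.sub h'.weakGrad.locInt_grad, fun ξ hξ i => ?_⟩,
    h.memLp_fun.sub h'.memLp_fun, h.memLp_grad.sub h'.memLp_grad⟩
  have key : ∀ {q η : Sp d → ℝ}, LocallyIntegrable q (vol D d) → Continuous η →
      (D = Dom.line → HasCompactSupport η) → Integrable (fun x => q x * η x) (vol D d) := by
    intro q η hq hη hc
    cases D with
    | line => exact hq.integrable_smul_right_of_hasCompactSupport hη (hc rfl)
    | torus =>
      obtain ⟨C, hC⟩ := exists_ae_bound (D := Dom.torus) hη hc
      exact (integrable_torus hq).mul_bdd hη.aestronglyMeasurable hC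
  have hd : Continuous fun x => (gradient ξ x) i := by
    simp only [gradient_apply]
    exact (hξ.smooth.contDiff.continuous_fderiv (by simp)).clm_apply continuous_const
  have hdc : D = Dom.line → HasCompactSupport fun x => (gradient ξ x) i := by
    intro hD
    simp only [gradient_apply]
    exact (hξ.compact hD).fderiv_apply ℝ _
  have hco : ∀ {Q : Sp d → Sp d}, LocallyIntegrable Q (vol D d) →
      LocallyIntegrable (fun x => Q x i) (vol D d) := fun hQ x =>
    (hQ x).imp fun s hs => ⟨hs.1, hs.2.eval_piLp i⟩
  simp only [sub_mul, PiLp.sub_apply]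
  rw [integral_sub (key h.weakGrad.locInt_fun hd hdc) (key h'.weakGrad.locInt_fun hd hdc),
    integral_sub (key (hco h.weakGrad.locInt_grad) hξ.continuous hξ.compact)
      (key (hco h'.weakGrad.locInt_grad) hξ.continuous hξ.compact),
    h.weakGrad.parts ξ hξ i, h'.weakGrad.parts ξ hξ i]
  ring

lemma IsTest.zero : IsTest D (0 : Sp d → ℝ) :=
  ⟨⟨by cases D <;> [trivial; exact fun _ _ => rfl], contDiff_const⟩, fun _ => .zero⟩

lemma memH1_const {W : Sp d → ℝ} (hW : IsPot D W) (c : ℝ) :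
    MemH1 D (gibbs D W) (fun _ => c) (fun _ => 0) := by
  have h := (IsTest.zero (D := D) (d := d)).memH1_sub_const hW (-c)
  have h0 : gradient (0 : Sp d → ℝ) = fun _ => 0 := by
    ext x i
    rw [gradient_apply]
    simp
  simpa [h0] using h

lemma ae_eq_of_integral_norm_sq_le {E : Type} [NormedAddCommGroup E] {m : Measure (Sp d)}
    {u v : Sp d → E} (h : MemLp (fun x => u x - v x) 2 m) (h0 : ∫ x, ‖u x - v x‖ ^ 2 ∂m ≤ 0) :
    u =ᵐ[m] v := by
  have h1 : ∫ x, ‖u x - v x‖ ^ 2 ∂m = 0 :=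
    le_antisymm h0 (integral_nonneg fun x => sq_nonneg _)
  have h2 := (integral_eq_zero_iff_of_nonneg (fun x => sq_nonneg _)
    ((memLp_two_iff_integrable_sq_norm h.1).1 h)).1 h1
  filter_upwards [h2] with x hx
  simpa [sub_eq_zero] using hx

/-- Two solutions may be tested against their difference, by `green`. Its energy therefore vanishes,
and Poincaré makes the difference itself vanish. -/
theorem Regular.poissonWellPosed (hVf : Standing D V f) (hU : Regular D V f U) :
    PoissonWellPosed D V f U := by
  have hW := hU.pot
  have := hW.isProbabilityMeasure
  obtain ⟨φ, G, hφ, h0, hw⟩ := exists_weak_solution hW hU.poincare hU.memLp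
  have hs : IsPoissonSol D V f U φ G := by
    refine ⟨hφ, h0, fun ξ hξ => ?_⟩
    have hξL := hξ.memLp hW
    have hξi : Integrable ξ (gibbs D (V + U)) := hξL.integrable (by norm_num)
    -- The weak solution is tested only against mean-zero functions, so the mean of `ξ` is
    -- subtracted; `integral_source` shows that this does not change the right side.
    rw [hw _ _ (hξ.memH1_sub_const hW (∫ x, ξ x ∂(gibbs D (V + U))))
      (by rw [integral_sub hξi (integrable_const _)]; simp)]
    simp only [mul_sub]
    have i1 : Integrable (fun x => (f x - mean D V f) * Real.exp (U x) * ξ x) (gibbs D (V + U)) :=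
      hU.memLp.integrable_mul hξL
    rw [integral_sub i1 ((hU.memLp.integrable (by norm_num)).mul_const _), integral_mul_const,
      integral_source hVf hU, zero_mul, sub_zero]
  refine ⟨φ, G, hs, fun φ' G' h' => ?_⟩
  have hd := h'.memH1.sub hφ
  have e1 := h'.weak_eq hVf hU hd
  have e2 := hs.weak_eq hVf hU hd
  have hG0 : ∫ x, ‖G' x - G x‖ ^ 2 ∂(gibbs D (V + U)) = 0 := by
    have e3 : ∀ x, ‖G' x - G x‖ ^ 2 = inner ℝ (G' x) (G' x - G x) - inner ℝ (G x) (G' x - G x) := by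
      intro x
      rw [← inner_sub_left, real_inner_self_eq_norm_sq]
    simp_rw [e3]
    rw [integral_sub (integrable_inner_of_memLp h'.memH1.memLp_grad hd.memLp_grad)
      (integrable_inner_of_memLp hφ.memLp_grad hd.memLp_grad), e1, e2, sub_self]
  obtain ⟨R, hR, hP⟩ := hU.poincare
  have hm : ∫ x, φ' x - φ x ∂(gibbs D (V + U)) = 0 := by
    rw [integral_sub (h'.memH1.memLp_fun.integrable (by norm_num))
      (hφ.memLp_fun.integrable (by norm_num)), h0, h'.mean_zero, sub_zero]
  have h3 := hP _ _ hd hm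
  rw [hG0, mul_zero] at h3
  refine ⟨hW.vol_ac.ae_eq (ae_eq_of_integral_norm_sq_le hd.memLp_fun ?_),
    hW.vol_ac.ae_eq (ae_eq_of_integral_norm_sq_le hd.memLp_grad hG0.le)⟩
  simpa using h3

/-! #### Bounded perturbations of the potential -/

lemma gibbs_le_smul {W W' : Sp d → ℝ} (hW : IsPot D W) (hW' : IsPot D W') {M : ℝ}
    (hM : ∀ᵐ x ∂(vol D d), |W x - W' x| ≤ M) :
    ∃ K : ℝ, 0 < K ∧ gibbs D W' ≤ ENNReal.ofReal K • gibbs D W := by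
  have hZ := hW.Zc_pos
  have hZ' := hW'.Zc_pos
  have hK : 0 < Real.exp M * Zc D W / Zc D W' := by positivity
  refine ⟨_, hK, ?_⟩
  rw [gibbs, gibbs, ← withDensity_smul _ (by
    exact hW.continuous_dens.measurable.ennreal_ofReal)]
  refine withDensity_mono ?_
  filter_upwards [hM] with x hx
  simp only [Pi.smul_apply, smul_eq_mul]
  rw [← ENNReal.ofReal_mul hK.le]
  refine ENNReal.ofReal_le_ofReal ?_
  have h1 : Real.exp (-W' x) ≤ Real.exp M * Real.exp (-W x) := by
    rw [← Real.exp_add]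
    exact Real.exp_le_exp.2 (by linarith [(abs_le.1 hx).2])
  calc Real.exp (-W' x) / Zc D W' ≤ Real.exp M * Real.exp (-W x) / Zc D W' := by gcongr
    _ = _ := by field_simp

lemma integral_le_of_le_smul {m m' : Measure (Sp d)} {K : ℝ} (hK : 0 < K)
    (hle : m' ≤ ENNReal.ofReal K • m) {h : Sp d → ℝ} (h0 : ∀ x, 0 ≤ h x) (hi : Integrable h m) :
    ∫ x, h x ∂m' ≤ K * ∫ x, h x ∂m := by
  have := integral_mono_measure hle (Eventually.of_forall h0)
    (hi.smul_measure ENNReal.ofReal_ne_top)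
  rwa [integral_smul_measure, ENNReal.toReal_ofReal hK.le, smul_eq_mul] at this

lemma MemH1.of_le_smul {m m' : Measure (Sp d)} {K : ℝ} (hle : m' ≤ ENNReal.ofReal K • m)
    {φ : Sp d → ℝ} {G : Sp d → Sp d} (h : MemH1 D m φ G) : MemH1 D m' φ G :=
  ⟨h.weakGrad, h.memLp_fun.of_measure_le_smul ENNReal.ofReal_ne_top hle,
    h.memLp_grad.of_measure_le_smul ENNReal.ofReal_ne_top hle⟩

/-- The Poincaré inequality is stable under bounded perturbations of the potential. -/
lemma Poincare.perturb {W W' : Sp d → ℝ} (hW : IsPot D W) (hW' : IsPot D W')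
    (hP : Poincare D (gibbs D W)) {M : ℝ} (hM : ∀ᵐ x ∂(vol D d), |W x - W' x| ≤ M) :
    Poincare D (gibbs D W') := by
  obtain ⟨R, hR, hP⟩ := hP
  obtain ⟨K, hK, hle⟩ := gibbs_le_smul hW hW' hM
  obtain ⟨K', hK', hle'⟩ := gibbs_le_smul hW' hW (M := M) (by
    filter_upwards [hM] with x hx; rwa [abs_sub_comm])
  have := hW.isProbabilityMeasure
  have := hW'.isProbabilityMeasure
  refine ⟨R / (K * K'), by positivity, fun φ G h h0 => ?_⟩
  have h1 : MemH1 D (gibbs D W) φ G := h.of_le_smul hle'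
  set c := ∫ x, φ x ∂(gibbs D W) with hc
  have h2 : MemH1 D (gibbs D W) (fun x => φ x - c) G := by
    simpa using h1.sub (memH1_const hW c)
  have h3 := hP _ _ h2 (by
    rw [integral_sub (h1.memLp_fun.integrable (by norm_num)) (integrable_const _)]
    simp [hc])
  -- As `φ` has mean zero for the perturbed measure, recentring it at its mean `c` for the original
  -- one can only increase the second moment.
  have h4 : ∫ x, φ x ^ 2 ∂(gibbs D W') ≤ ∫ x, (φ x - c) ^ 2 ∂(gibbs D W') := by
    have i1 := h.memLp_fun.integrable_sq
    have i2 : Integrable φ (gibbs D W') := h.memLp_fun.integrable (by norm_num)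
    have e : ∀ x, (φ x - c) ^ 2 = φ x ^ 2 - (2 * c * φ x - c ^ 2) := fun x => by ring
    simp_rw [e]
    have i3 : Integrable (fun x => 2 * c * φ x - c ^ 2) (gibbs D W') :=
      (i2.const_mul _).sub (integrable_const _)
    rw [integral_sub i1 i3, integral_sub (i2.const_mul _) (integrable_const _), integral_const_mul, h0]
    simp
    positivity
  have h5 := integral_le_of_le_smul hK hle (fun x => sq_nonneg (φ x - c)) h2.memLp_fun.integrable_sq
  have h6 := integral_le_of_le_smul hK' hle' (fun x => sq_nonneg ‖G x‖)
    h.memLp_grad.integrable_norm_pow'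
  calc ∫ x, φ x ^ 2 ∂(gibbs D W') ≤ K * ∫ x, (φ x - c) ^ 2 ∂(gibbs D W) := h4.trans h5
    _ ≤ K * (1 / R * ∫ x, ‖G x‖ ^ 2 ∂(gibbs D W)) := by gcongr
    _ ≤ K * (1 / R * (K' * ∫ x, ‖G x‖ ^ 2 ∂(gibbs D W'))) := by gcongr
    _ = _ := by field_simp

/-- `δ` is bounded almost everywhere, so weights and source change by factors at most `e^{|ε| C}`.
-/
lemma Regular.perturb (hVf : Standing D V f) (hU : Regular D V f U) {δ : Sp d → ℝ}
    (hδ : IsTest D δ) (ε : ℝ) : Regular D V f (U + ε • δ) := by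
  obtain ⟨C, hC⟩ := exists_ae_bound hδ.continuous hδ.compact
  have hs : IsSmooth D (U + ε • δ) := hU.smooth.add (hδ.smooth.const_smul ε)
  have hbd : ∀ᵐ x ∂(vol D d), |ε * δ x| ≤ |ε| * C := by
    filter_upwards [hC] with x hx
    rw [abs_mul]
    exact mul_le_mul_of_nonneg_left hx (abs_nonneg _)
  have hpot : IsPot D (V + (U + ε • δ)) := by
    refine ⟨hVf.smooth_pot.add hs, ?_⟩
    have h1 := hU.pot.integrable.bdd_mul (f := fun x => Real.exp (-(ε * δ x)))
      (c := Real.exp (|ε| * C))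
      (Real.continuous_exp.comp (hδ.continuous.const_mul ε).neg).aestronglyMeasurable (by
        filter_upwards [hbd] with x hx
        rw [Real.norm_eq_abs, Real.abs_exp]
        exact Real.exp_le_exp.2 (by linarith [(abs_le.1 hx).1]))
    refine h1.congr (Eventually.of_forall fun x => ?_)
    simp only [← Real.exp_add, Pi.add_apply, Pi.smul_apply, smul_eq_mul]
    congr 1
    ring
  have hM : ∀ᵐ x ∂(vol D d), |(V + U) x - (V + (U + ε • δ)) x| ≤ |ε| * C := by
    filter_upwards [hbd] with x hx
    rw [← abs_neg]
    simpa [add_assoc] using hx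
  refine ⟨hs, hpot, hU.poincare.perturb hU.pot hpot hM, ?_⟩
  obtain ⟨K, hK, hle⟩ := gibbs_le_smul hU.pot hpot hM
  refine MemLp.of_measure_le_smul ENNReal.ofReal_ne_top hle ?_
  refine hU.memLp.of_le_mul (c := Real.exp (|ε| * C)) ?_ (hU.pot.gibbs_ac ?_)
  · exact (((hVf.smooth_obs.contDiff.continuous).sub continuous_const).mul
      (Real.continuous_exp.comp hs.contDiff.continuous)).aestronglyMeasurable
  · filter_upwards [hbd] with x hx
    have e : (f x - mean D V f) * Real.exp ((U + ε • δ) x) =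
        Real.exp (ε * δ x) * ((f x - mean D V f) * Real.exp (U x)) := by
      simp only [Pi.add_apply, Pi.smul_apply, smul_eq_mul, Real.exp_add]
      ring
    rw [e, norm_mul, Real.norm_eq_abs, Real.abs_exp]
    exact mul_le_mul_of_nonneg_right (Real.exp_le_exp.2 (abs_le.1 hx).2) (norm_nonneg _)

/-! ### Differentiation of the energy -/

/-- A quadratic remainder gives differentiability, and at `ε = 0` the same bound identifies `F 0`.
-/
lemma hasDerivAt_of_abs_le_sq {F : ℝ → ℝ} {a L K r : ℝ} (hr : 0 < r)
    (h : ∀ ε : ℝ, |ε| ≤ r → |F ε - a - ε * L| ≤ K * ε ^ 2) : HasDerivAt F L 0 ∧ F 0 = a := by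
  have h0 : F 0 = a := by
    have := h 0 (by simpa using hr.le)
    simpa [sub_eq_zero] using this
  refine ⟨?_, h0⟩
  rw [hasDerivAt_iff_isLittleO_nhds_zero]
  have hb : (fun ε : ℝ => F (0 + ε) - F 0 - ε • L) =O[𝓝 0] fun ε : ℝ => ε ^ 2 := by
    refine Asymptotics.IsBigO.of_bound K ?_
    filter_upwards [Metric.closedBall_mem_nhds (0 : ℝ) hr] with ε hε
    rw [zero_add, h0, smul_eq_mul, Real.norm_eq_abs, Real.norm_eq_abs, abs_sq]
    exact h ε (by simpa using hε)
  refine hb.trans_isLittleO ?_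
  simpa using Asymptotics.isLittleO_pow_pow (𝕜 := ℝ) (m := 1) (n := 2) one_lt_two

lemma integral_norm_mul_norm_le {μ : Measure (Sp d)} {G H : Sp d → Sp d} (hG : MemLp G 2 μ)
    (hH : MemLp H 2 μ) :
    ∫ x, ‖G x‖ * ‖H x‖ ∂μ ≤ √(∫ x, ‖G x‖ ^ 2 ∂μ) * √(∫ x, ‖H x‖ ^ 2 ∂μ) := by
  have key : ∀ {Q : Sp d → Sp d} (hQ : MemLp Q 2 μ),
      ‖hQ.norm.toLp (fun x => ‖Q x‖)‖ = √(∫ x, ‖Q x‖ ^ 2 ∂μ) := by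
    intro Q hQ
    rw [eq_comm, Real.sqrt_eq_iff_mul_self_eq (integral_nonneg fun x => sq_nonneg _) (norm_nonneg _),
      ← sq, norm_sq_toLp]
    refine integral_congr_ae ?_
    filter_upwards [hQ.norm.coeFn_toLp] with x hx
    rw [hx]
    simp
  rw [← key hG, ← key hH]
  refine le_trans (le_of_eq ?_) (real_inner_le_norm (hG.norm.toLp fun x => ‖G x‖)
    (hH.norm.toLp fun x => ‖H x‖))
  rw [L2.inner_def]
  refine integral_congr_ae ?_
  filter_upwards [hG.norm.coeFn_toLp, hH.norm.coeFn_toLp] with x h1 h2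
  rw [h1, h2]
  simp [mul_comm]

lemma abs_integral_mul_le {μ : Measure (Sp d)} {q p p' : Sp d → ℝ} {B : ℝ}
    (hq : ∀ᵐ x ∂μ, |q x| ≤ B) (hp : ∀ x, |p x| ≤ p' x) (hi : Integrable p' μ) :
    |∫ x, q x * p x ∂μ| ≤ B * ∫ x, p' x ∂μ := by
  rw [← integral_const_mul]
  rw [← Real.norm_eq_abs]
  refine norm_integral_le_of_norm_le (hi.const_mul B) ?_
  filter_upwards [hq] with x hx
  rw [norm_mul]
  exact mul_le_mul hx (hp x) (norm_nonneg _) ((abs_nonneg _).trans hx)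

lemma integral_sub_sub {μ : Measure (Sp d)} {p q r : Sp d → ℝ} (hp : Integrable p μ)
    (hq : Integrable q μ) (hr : Integrable r μ) :
    ∫ x, p x - q x - r x ∂μ = ∫ x, p x ∂μ - ∫ x, q x ∂μ - ∫ x, r x ∂μ := by
  have hpq : Integrable (fun x => p x - q x) μ := hp.sub hq
  rw [integral_sub hpq hr, integral_sub hp hq]

/-- The three bounds serve coercivity (from `e < 3`), the first-order size of the error, and the
second-order Taylor remainder. -/
lemma abs_exp_neg_bounds {y b : ℝ} (hy : |y| ≤ b) (hb : b ≤ 1) :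
    1 / 3 ≤ Real.exp (-y) ∧ |1 - Real.exp (-y)| ≤ 2 * b ∧ |1 - Real.exp (-y) - y| ≤ b ^ 2 := by
  have h1 : |-y| ≤ 1 := by rw [abs_neg]; exact hy.trans hb
  refine ⟨?_, ?_, ?_⟩
  · have h2 : Real.exp (-1) ≤ Real.exp (-y) := Real.exp_le_exp.2 (by linarith [(abs_le.1 (hy.trans hb)).2])
    have h3 : (1 : ℝ) / 3 ≤ Real.exp (-1) := by
      rw [Real.exp_neg, ← one_div]
      exact one_div_le_one_div_of_le (Real.exp_pos 1) (Real.exp_one_lt_d9.le.trans (by norm_num))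
    exact h3.trans h2
  · have := Real.abs_exp_sub_one_le h1
    rw [abs_sub_comm, abs_neg] at this
    linarith
  · have := Real.abs_exp_sub_one_sub_id_le h1
    rw [abs_sub_comm] at this
    have e : 1 - Real.exp (-y) - y = -y - (Real.exp (-y) - 1) := by ring
    rw [e]
    refine this.trans ?_
    rw [neg_sq, ← sq_abs]
    gcongr

section Energy

variable {μ : Measure (Sp d)} {δ : Sp d → ℝ} {C : ℝ}

lemma integrable_exp_mul (hδ : AEStronglyMeasurable δ μ) (hC : ∀ᵐ x ∂μ, |δ x| ≤ C) (ε : ℝ)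
    {p : Sp d → ℝ} (hp : Integrable p μ) :
    Integrable (fun x => Real.exp (-(ε * δ x)) * p x) μ := by
  refine hp.bdd_mul (c := Real.exp (|ε| * C))
    (Real.continuous_exp.comp_aestronglyMeasurable (hδ.const_mul ε).neg) ?_
  filter_upwards [hC] with x hx
  rw [Real.norm_eq_abs, Real.abs_exp, Real.exp_le_exp]
  refine (neg_le_abs _).trans ?_
  rw [abs_mul]
  gcongr

/-- The derivative of the energy of solutions to a perturbed weak equation. -/
theorem hasDerivAt_energy (hδ : AEStronglyMeasurable δ μ) (hC0 : 0 ≤ C)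
    (hC : ∀ᵐ x ∂μ, |δ x| ≤ C) {G : Sp d → Sp d} {Γ : ℝ → Sp d → Sp d} (hG : MemLp G 2 μ)
    (hΓ : ∀ ε, MemLp (Γ ε) 2 μ)
    (h1 : ∀ ε, ∫ x, Real.exp (-(ε * δ x)) * inner ℝ (Γ ε x) (G x) ∂μ =
      ∫ x, inner ℝ (G x) (G x) ∂μ)
    (h2 : ∀ ε, ∫ x, Real.exp (-(ε * δ x)) * inner ℝ (Γ ε x) (Γ ε x) ∂μ =
      ∫ x, inner ℝ (G x) (Γ ε x) ∂μ) :
    HasDerivAt (fun ε => ∫ x, Real.exp (-(ε * δ x)) * ‖Γ ε x‖ ^ 2 ∂μ) (∫ x, δ x * ‖G x‖ ^ 2 ∂μ) 0 ∧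
      ∫ x, Real.exp (-(0 * δ x)) * ‖Γ 0 x‖ ^ 2 ∂μ = ∫ x, ‖G x‖ ^ 2 ∂μ := by
  set A := ∫ x, ‖G x‖ ^ 2 ∂μ with hA
  have hA0 : 0 ≤ A := integral_nonneg fun x => sq_nonneg _
  -- The radius ensures `|ε| C ≤ 1`. In `13 = 1 + 12`, the 1 bounds the Taylor remainder `Q` and the
  -- 12 bounds the error term `T`.
  refine hasDerivAt_of_abs_le_sq (K := 13 * C ^ 2 * A) (r := 1 / (C + 1)) (by positivity)
    fun ε hε => ?_
  have hεC : |ε| * C ≤ 1 := by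
    rw [le_div_iff₀ (by positivity)] at hε
    nlinarith [abs_nonneg ε]
  set b := |ε| * C with hb
  have hb0 : 0 ≤ b := by positivity
  set e : Sp d → ℝ := fun x => Real.exp (-(ε * δ x)) with he
  have hbd : ∀ᵐ x ∂μ, 1 / 3 ≤ e x ∧ |1 - e x| ≤ 2 * b ∧ |1 - e x - ε * δ x| ≤ b ^ 2 := by
    filter_upwards [hC] with x hx
    refine abs_exp_neg_bounds (b := b) ?_ hεC
    rw [abs_mul]
    exact mul_le_mul_of_nonneg_left hx (abs_nonneg _)
  set E : Sp d → Sp d := fun x => Γ ε x - G x with hE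
  have hEL : MemLp E 2 μ := (hΓ ε).sub hG
  have iGG := integrable_inner_of_memLp hG hG
  have iGE := integrable_inner_of_memLp hG hEL
  have iEE := integrable_inner_of_memLp hEL hEL
  have iGΓ := integrable_inner_of_memLp hG (hΓ ε)
  have iΓG := integrable_inner_of_memLp (hΓ ε) hG
  have iΓΓ := integrable_inner_of_memLp (hΓ ε) (hΓ ε)
  have je : ∀ {p : Sp d → ℝ}, Integrable p μ → Integrable (fun x => e x * p x) μ :=
    fun hp => integrable_exp_mul hδ hC ε hp
  have hG2 : ∀ x, inner ℝ (G x) (G x) = ‖G x‖ ^ 2 := fun x => real_inner_self_eq_norm_sq _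
  have hΓ2 : ∀ x, inner ℝ (Γ ε x) (Γ ε x) = ‖Γ ε x‖ ^ 2 := fun x => real_inner_self_eq_norm_sq _
  set N2 := ∫ x, ‖E x‖ ^ 2 ∂μ with hN2
  have hN0 : 0 ≤ N2 := integral_nonneg fun x => sq_nonneg _
  set T := ∫ x, (1 - e x) * inner ℝ (G x) (E x) ∂μ with hT
  have hTb : |T| ≤ 2 * b * (√A * √N2) := by
    refine (abs_integral_mul_le (hbd.mono fun x hx => hx.2.1)
      (fun x => abs_real_inner_le_norm (G x) (E x)) (hG.norm.integrable_mul hEL.norm)).trans ?_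
    gcongr
    exact integral_norm_mul_norm_le hG hEL
  -- `E` solves the perturbed equation with right side `(1 - e) G`, tested here against `E` itself.
  have hGE : ∫ x, e x * inner ℝ (E x) (E x) ∂μ = T := by
    have p : ∀ x, e x * inner ℝ (E x) (E x) = e x * inner ℝ (Γ ε x) (Γ ε x)
        - e x * inner ℝ (Γ ε x) (G x) - e x * inner ℝ (G x) (E x) := by
      intro x
      simp only [hE, inner_sub_left, inner_sub_right]
      ring
    have q : ∀ x, (1 - e x) * inner ℝ (G x) (E x) = inner ℝ (G x) (Γ ε x) - inner ℝ (G x) (G x)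
        - e x * inner ℝ (G x) (E x) := by
      intro x
      simp only [hE, inner_sub_right]
      ring
    have s1 : ∫ x, e x * inner ℝ (E x) (E x) ∂μ = ∫ x, e x * inner ℝ (Γ ε x) (Γ ε x) ∂μ
        - ∫ x, e x * inner ℝ (Γ ε x) (G x) ∂μ - ∫ x, e x * inner ℝ (G x) (E x) ∂μ := by
      rw [← integral_sub_sub (je iΓΓ) (je iΓG) (je iGE)]
      exact integral_congr_ae (Eventually.of_forall p)
    have s2 : T = ∫ x, inner ℝ (G x) (Γ ε x) ∂μ - ∫ x, inner ℝ (G x) (G x) ∂μ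
        - ∫ x, e x * inner ℝ (G x) (E x) ∂μ := by
      rw [← integral_sub_sub iGΓ iGG (je iGE)]
      exact integral_congr_ae (Eventually.of_forall q)
    rw [s1, s2, h1 ε, h2 ε]
  have hN : 1 / 3 * N2 ≤ T := by
    rw [← hGE, hN2, ← integral_const_mul]
    refine integral_mono_ae ((iEE.congr (Eventually.of_forall fun x =>
      real_inner_self_eq_norm_sq _)).const_mul _) (je iEE) ?_
    filter_upwards [hbd] with x hx
    rw [real_inner_self_eq_norm_sq]
    exact mul_le_mul_of_nonneg_right hx.1 (sq_nonneg _)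
  -- Dividing `N2 / 3 ≤ 2 b √A √N2` by `√N2` shows that `E` is of order `ε`; inserted in `hTb`, this
  -- makes `T` of order `ε²`.
  have hsN : √N2 ≤ 6 * b * √A := by
    have h3 := hN.trans ((le_abs_self _).trans hTb)
    have h4 := Real.sq_sqrt hN0
    rcases (Real.sqrt_nonneg N2).eq_or_lt with h5 | h5
    · rw [← h5]; positivity
    · refine le_of_mul_le_mul_right ?_ h5
      nlinarith
  have hT2 : |T| ≤ 12 * b ^ 2 * A := by
    calc |T| ≤ 2 * b * (√A * √N2) := hTb
      _ ≤ 2 * b * (√A * (6 * b * √A)) := by gcongr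
      _ = 12 * b ^ 2 * (√A * √A) := by ring
      _ = _ := by rw [Real.mul_self_sqrt hA0]
  have iq : Integrable (fun x => δ x * ‖G x‖ ^ 2) μ :=
    (iGG.congr (Eventually.of_forall hG2)).bdd_mul hδ hC
  have iG2 := iGG.congr (Eventually.of_forall hG2)
  set Q := ∫ x, (1 - e x - ε * δ x) * ‖G x‖ ^ 2 ∂μ with hQ
  have hQb : |Q| ≤ b ^ 2 * A :=
    abs_integral_mul_le (hbd.mono fun x hx => hx.2.2) (fun x => (abs_of_nonneg (sq_nonneg _)).le) iG2
  have hmain : (∫ x, e x * ‖Γ ε x‖ ^ 2 ∂μ) - A - ε * ∫ x, δ x * ‖G x‖ ^ 2 ∂μ = Q + T := by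
    have t1 : ∫ x, e x * ‖Γ ε x‖ ^ 2 ∂μ = ∫ x, inner ℝ (G x) (Γ ε x) ∂μ := by
      rw [← h2 ε]; simp only [hΓ2, he]
    have t2 : A = ∫ x, e x * inner ℝ (Γ ε x) (G x) ∂μ := by
      rw [h1 ε]; simp only [hG2, hA]
    have t3 : Q = (∫ x, ‖G x‖ ^ 2 ∂μ) - (∫ x, e x * ‖G x‖ ^ 2 ∂μ)
        - ε * ∫ x, δ x * ‖G x‖ ^ 2 ∂μ := by
      rw [← integral_const_mul, ← integral_sub_sub iG2 (je iG2) (iq.const_mul ε)]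
      refine integral_congr_ae (Eventually.of_forall fun x => ?_)
      simp only
      ring
    have j4 : Integrable (fun x => e x * inner ℝ (Γ ε x) (G x) - e x * ‖G x‖ ^ 2) μ :=
      (je iΓG).sub (je iG2)
    have t4 : T = ∫ x, inner ℝ (G x) (Γ ε x) ∂μ - (∫ x, ‖G x‖ ^ 2 ∂μ)
        - ((∫ x, e x * inner ℝ (Γ ε x) (G x) ∂μ) - ∫ x, e x * ‖G x‖ ^ 2 ∂μ) := by
      rw [← integral_sub (je iΓG) (je iG2), ← integral_sub_sub iGΓ iG2 j4]
      refine integral_congr_ae (Eventually.of_forall fun x => ?_)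
      simp only [hE, inner_sub_right, hG2, real_inner_comm (G x) (Γ ε x)]
      ring
    rw [t1]
    linarith
  rw [hmain]
  have hb2 : b ^ 2 = C ^ 2 * ε ^ 2 := by rw [hb, mul_pow, sq_abs]; ring
  calc |Q + T| ≤ |Q| + |T| := abs_add_le _ _
    _ ≤ b ^ 2 * A + 12 * b ^ 2 * A := add_le_add hQb hT2
    _ = 13 * C ^ 2 * A * ε ^ 2 := by rw [hb2]; ring

/-- For `μ = μ_U` this integral is the ratio `Z[U + εδ] / Z[U]`. -/
lemma hasDerivAt_integral_exp [IsProbabilityMeasure μ] (hδ : AEStronglyMeasurable δ μ)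
    (hC0 : 0 ≤ C) (hC : ∀ᵐ x ∂μ, |δ x| ≤ C) :
    HasDerivAt (fun ε => ∫ x, Real.exp (-(ε * δ x)) ∂μ) (-∫ x, δ x ∂μ) 0 ∧
      ∫ x, Real.exp (-(0 * δ x)) ∂μ = 1 := by
  refine hasDerivAt_of_abs_le_sq (K := C ^ 2) (r := 1 / (C + 1)) (by positivity)
    fun ε hε => ?_
  have hεC : |ε| * C ≤ 1 := by
    rw [le_div_iff₀ (by positivity)] at hε
    nlinarith [abs_nonneg ε]
  have i1 : Integrable (fun x => Real.exp (-(ε * δ x))) μ := by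
    simpa using integrable_exp_mul hδ hC ε (integrable_const (1 : ℝ))
  have i2 : Integrable δ μ := Integrable.of_bound hδ C hC
  have h : ∫ x, (1 - Real.exp (-(ε * δ x)) - ε * δ x) * 1 ∂μ =
      -((∫ x, Real.exp (-(ε * δ x)) ∂μ) - 1 - ε * (-∫ x, δ x ∂μ)) := by
    have i3 : Integrable (fun x => 1 - Real.exp (-(ε * δ x))) μ := (integrable_const _).sub i1
    simp only [mul_one]
    rw [integral_sub i3 (i2.const_mul ε), integral_sub (integrable_const _) i1, integral_const_mul]
    simp
    ring
  rw [← abs_neg, ← h]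
  have hb : ∀ᵐ x ∂μ, |1 - Real.exp (-(ε * δ x)) - ε * δ x| ≤ (|ε| * C) ^ 2 := by
    filter_upwards [hC] with x hx
    refine (abs_exp_neg_bounds ?_ hεC).2.2
    rw [abs_mul]
    gcongr
  refine (abs_integral_mul_le (p' := fun _ => 1) hb (fun x => by simp) (integrable_const _)).trans ?_
  rw [mul_pow, sq_abs]
  simp [mul_comm]

end Energy

lemma Zc_perturb_mul_integral (hVf : Standing D V f) (hU : Regular D V f U) {δ : Sp d → ℝ}
    (hδ : IsTest D δ) (ε : ℝ) (h : Sp d → ℝ) :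
    Zc D (V + (U + ε • δ)) * ∫ x, h x ∂(gibbs D (V + (U + ε • δ))) =
      Zc D (V + U) * ∫ x, Real.exp (-(ε * δ x)) * h x ∂(gibbs D (V + U)) := by
  rw [Zc_mul_integral (hU.perturb hVf hδ ε).pot, Zc_mul_integral hU.pot]
  refine integral_congr_ae (Eventually.of_forall fun x => ?_)
  simp only
  rw [← mul_assoc, ← Real.exp_add]
  congr 2
  simp only [Pi.add_apply, Pi.smul_apply, smul_eq_mul]
  ring

/-- The perturbed Poisson equation, written in terms of the unperturbed Gibbs measure. -/
lemma IsPoissonSol.perturb_weak_eq (hVf : Standing D V f) (hU : Regular D V f U) {δ : Sp d → ℝ}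
    (hδ : IsTest D δ) {ε : ℝ} {φ φ' : Sp d → ℝ} {G G' : Sp d → Sp d}
    (h : IsPoissonSol D V f U φ G) (h' : IsPoissonSol D V f (U + ε • δ) φ' G')
    {ψ : Sp d → ℝ} {H : Sp d → Sp d} (hψ : MemH1 D (gibbs D (V + U)) ψ H)
    (hψ' : MemH1 D (gibbs D (V + (U + ε • δ))) ψ H) :
    ∫ x, Real.exp (-(ε * δ x)) * inner ℝ (G' x) (H x) ∂(gibbs D (V + U)) =
      ∫ x, inner ℝ (G x) (H x) ∂(gibbs D (V + U)) := by
  have hU' := hU.perturb hVf hδ ε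
  have hZ := hU.pot.Zc_pos.ne'
  refine mul_left_cancel₀ hZ ?_
  rw [← Zc_perturb_mul_integral hVf hU hδ ε fun x => inner ℝ (G' x) (H x), h'.weak_eq hVf hU' hψ',
    h.weak_eq hVf hU hψ, Zc_mul_integral_source hU', Zc_mul_integral_source hU]

/-- Comparable measures have the same `H¹`, so each of the two solutions is admissible in the
equation of the other. -/
lemma MemH1.perturb_iff (hVf : Standing D V f) (hU : Regular D V f U) {δ : Sp d → ℝ}
    (hδ : IsTest D δ) (ε : ℝ) {ψ : Sp d → ℝ} {H : Sp d → Sp d} :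
    MemH1 D (gibbs D (V + U)) ψ H ↔ MemH1 D (gibbs D (V + (U + ε • δ))) ψ H := by
  obtain ⟨C, hC⟩ := exists_ae_bound hδ.continuous hδ.compact
  have hpot := (hU.perturb hVf hδ ε).pot
  have hM : ∀ᵐ x ∂(vol D d), |(V + U) x - (V + (U + ε • δ)) x| ≤ |ε| * C := by
    filter_upwards [hC] with x hx
    have e : (V + U) x - (V + (U + ε • δ)) x = -(ε * δ x) := by
      simp only [Pi.add_apply, Pi.smul_apply, smul_eq_mul]
      ring
    rw [e, abs_neg, abs_mul]
    exact mul_le_mul_of_nonneg_left hx (abs_nonneg _)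
  obtain ⟨K, -, hle⟩ := gibbs_le_smul hU.pot hpot hM
  obtain ⟨K', -, hle'⟩ := gibbs_le_smul hpot hU.pot (M := |ε| * C) (by
    filter_upwards [hM] with x hx; rwa [abs_sub_comm])
  exact ⟨fun h => h.of_le_smul hle, fun h => h.of_le_smul hle'⟩

/-- The default value `0` of `poissonGrad` is never used. -/
lemma Regular.exists_isPoissonSol_poissonGrad (hVf : Standing D V f) (hU : Regular D V f U) :
    ∃ φ, IsPoissonSol D V f U φ (poissonGrad D V f U) := by
  obtain ⟨φ, G, h, -⟩ := hU.poissonWellPosed hVf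
  have hex : ∃ G φ, IsPoissonSol D V f U φ G := ⟨G, φ, h⟩
  rw [poissonGrad, dif_pos hex]
  exact hex.choose_spec

/-- The directional derivative of the asymptotic variance. -/
theorem hasDirDeriv_asymVar (hVf : Standing D V f) (hU : Regular D V f U) {δ : Sp d → ℝ}
    (hδ : IsTest D δ) {φ : Sp d → ℝ} {G : Sp d → Sp d} (h : IsPoissonSol D V f U φ G) :
    HasDirDeriv (asymVar D V f) U δ (2 * (Zc D (V + U) ^ 2 / Zc D V ^ 2 *
      ∫ x, δ x * (‖G x‖ ^ 2 - ∫ y, ‖G y‖ ^ 2 ∂(gibbs D (V + U))) ∂(gibbs D (V + U)))) := by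
  set μ := gibbs D (V + U) with hμ
  set Z := Zc D (V + U) with hZ
  have := hU.pot.isProbabilityMeasure
  obtain ⟨C, hC⟩ := exists_ae_bound hδ.continuous hδ.compact
  replace hC : ∀ᵐ x ∂μ, |δ x| ≤ C := hU.pot.gibbs_ac hC
  have hC0 : 0 ≤ C := by
    obtain ⟨x, hx⟩ := hC.exists
    exact (abs_nonneg _).trans hx
  have hδm : AEStronglyMeasurable δ μ := hδ.continuous.aestronglyMeasurable
  have hex := fun ε => (hU.perturb hVf hδ ε).exists_isPoissonSol_poissonGrad hVf
  choose Φ hΦ using hex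
  set Γ := fun ε : ℝ => poissonGrad D V f (U + ε • δ) with hΓ
  have hΦH : ∀ ε, MemH1 D μ (Φ ε) (Γ ε) := fun ε => (MemH1.perturb_iff hVf hU hδ ε).2 (hΦ ε).memH1
  -- `G` belongs to an arbitrary solution and need not be the chosen gradient `Γ 0`; `hJ0` shows
  -- that the energies agree.
  obtain ⟨hJ, hJ0⟩ := hasDerivAt_energy hδm hC0 hC h.memH1.memLp_grad (fun ε => (hΦH ε).memLp_grad)
    (fun ε => h.perturb_weak_eq hVf hU hδ (hΦ ε) h.memH1
      ((MemH1.perturb_iff hVf hU hδ ε).1 h.memH1))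
    (fun ε => h.perturb_weak_eq hVf hU hδ (hΦ ε) (hΦH ε) (hΦ ε).memH1)
  obtain ⟨hm, hm0⟩ := hasDerivAt_integral_exp hδm hC0 hC
  -- Of the two factors `Z[U + εδ]`, one changes the measure in the energy and the other becomes the
  -- integral of `exp(-ε δ)`.
  have hS : ∀ ε : ℝ, asymVar D V f (U + ε • δ) = 2 * Z ^ 2 / Zc D V ^ 2 *
      ((∫ x, Real.exp (-(ε * δ x)) ∂μ) * ∫ x, Real.exp (-(ε * δ x)) * ‖Γ ε x‖ ^ 2 ∂μ) := by
    intro ε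
    have e1 := Zc_perturb_mul_integral hVf hU hδ ε fun x => ‖Γ ε x‖ ^ 2
    have e2 := Zc_perturb_mul_integral hVf hU hδ ε fun _ => 1
    have := (hU.perturb hVf hδ ε).pot.isProbabilityMeasure
    simp only [mul_one, integral_const, probReal_univ, smul_eq_mul] at e2
    calc asymVar D V f (U + ε • δ) = 2 / Zc D V ^ 2 * (Zc D (V + (U + ε • δ)) *
          (Zc D (V + (U + ε • δ)) * ∫ x, ‖Γ ε x‖ ^ 2 ∂(gibbs D (V + (U + ε • δ))))) := by
          simp only [asymVar, hΓ]; ring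
      _ = _ := by rw [e1, e2]; ring
  have hD := (hm.mul hJ).const_mul (2 * Z ^ 2 / Zc D V ^ 2)
  rw [hm0, hJ0] at hD
  have hslope := hasDerivAt_iff_tendsto_slope_zero.1 hD
  have hL : 2 * Z ^ 2 / Zc D V ^ 2 * ((-∫ x, δ x ∂μ) * ∫ x, ‖G x‖ ^ 2 ∂μ + 1 *
      ∫ x, δ x * ‖G x‖ ^ 2 ∂μ) = 2 * (Z ^ 2 / Zc D V ^ 2 *
      ∫ x, δ x * (‖G x‖ ^ 2 - ∫ y, ‖G y‖ ^ 2 ∂μ) ∂μ) := by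
    have i1 : Integrable (fun x => ‖G x‖ ^ 2) μ :=
      (memLp_two_iff_integrable_sq_norm h.memH1.memLp_grad.1).1 h.memH1.memLp_grad
    simp only [mul_sub]
    rw [integral_sub (i1.bdd_mul hδm hC) ((Integrable.of_bound hδm C hC).mul_const _),
      integral_mul_const]
    ring
  rw [← hL]
  refine hslope.congr fun ε => ?_
  simp only [zero_add, one_div, smul_eq_mul, Pi.mul_apply]
  have h0 := hS 0
  rw [zero_smul, add_zero] at h0
  rw [hS ε, h0]

end AsymVar

end

theorem mainTheorem3 (d : ℕ) (D : AsymVar.Dom) (V f : AsymVar.Sp d → ℝ)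
    (hVf : AsymVar.Standing D V f)
    (U : AsymVar.Sp d → ℝ) (hU : AsymVar.Admissible D V f U)
    (δU : AsymVar.Sp d → ℝ) (hδU : AsymVar.IsTest D δU) :
    (∀ ε : ℝ, AsymVar.PoissonWellPosed D V f (U + ε • δU)) ∧
    ∀ (φ : AsymVar.Sp d → ℝ) (G : AsymVar.Sp d → AsymVar.Sp d),
      AsymVar.IsPoissonSol D V f U φ G →
      ∃ L : ℝ, AsymVar.HasDirDeriv (AsymVar.asymVar D V f) U δU L ∧
        1 / 2 * L =
          AsymVar.Zc D (V + U) ^ 2 / AsymVar.Zc D V ^ 2 *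
            ∫ x, δU x * (‖G x‖ ^ 2 - ∫ y, ‖G y‖ ^ 2 ∂(AsymVar.gibbs D (V + U)))
              ∂(AsymVar.gibbs D (V + U)) := by
  have hR := hU.regular hVf
  refine ⟨fun ε => (hR.perturb hVf hδU ε).poissonWellPosed hVf, fun φ G h => ?_⟩
  exact ⟨_, AsymVar.hasDirDeriv_asymVar hVf hR hδU h, by rw [← mul_assoc]; norm_num⟩
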